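/- Let $\Bbbk$ be an algebraically closed field of characteristic $0$, let $n,w\ge 1$ be integers and let $\gamma\in\Bbbk$ be a primitive $n$-th root of unity. Let $H=B(n,w,\gamma)$ be the generalized Liu algebra: the Hopf algebra generated by $x^{\pm1},g,y$ with relations $$xx^{-1}=x^{-1}x=1,\quad xg=gx,\quad xy=yx,\quad yg=\gamma gy,\quad y^n=1-x^w=1-g^n,$$ with $\Delta(x)=x\otimes x$, $\Delta(g)=g\otimes g$, $\Delta(y)=y\otimes g+1\otimes y$, $\varepsilon(x)=\varepsilon(g)=1$, $\varepsilon(y)=0$, $S(x)=x^{-1}$, $S(g)=g^{-1}$, $S(y)=-yg^{-1}$. A Yetter–Drinfeld module over $H$ is a left $H$-module and left $H$-comodule $(V,\cdot,\delta)$ with $\delta(h\cdot v)=h_{(1)}v_{(-1)}S(h_{(3)})\otimes h_{(2)}\cdot v_{(0)}$ for all $h\in H$, $v\in V$; isomorphisms are linear bijections preserving action and coaction, and $V$ is simple if it is nonzero and has no Yetter–Drinfeld submodule other than $0$ and $V$. For $a\in\mathbb Z$ let $\phi(a)$ be the unique element of $\{1,\dots,n\}$ with $\phi(a)\equiv a \pmod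 n$. For $\beta\in\Bbbk^*$ and $r,i\in\mathbb Z$ define $c(k,l)=c_\beta^{r,i}(k,l)\in H$ for $0\le l\le k$ by $c(0,0)=x^rg^i$ and $$c(k+1,l)=\begin{cases} c(k,0)S(y)+\beta\, y\,c(k,0)S(g), & l=0,\\ c(k,l)S(y)+\beta\gamma^{-l}\,y\,c(k,l)S(g)+c(k,l-1)S(g), & 0<l<k+1,\\ c(k,k)S(g), & l=k+1.\end{cases}$$ For $\alpha,\beta\in\Bbbk^*$ and $r,i\in\mathbb Z$ with $\alpha^w=\beta^n$, let $V(\alpha,\beta,x^rg^i)$ be the vector space with basis $v_0,\dots,v_m$, where $m=n-\phi(-i-j)$ if $\beta=\gamma^j$ for some $j\in\mathbb Z$, and $m=n-1$ if $\beta^n\neq1$, with, for $0\le k\le m$, $$x\cdot v_k=\alpha v_k,\qquad g\cdot v_k=\beta\gamma^{-k}v_k,\qquad y\cdot v_k=\begin{cases}v_{k+1},&k<m,\\(1-\beta^n)v_0,&k=m,\end{cases}\qquad \delta(v_k)=\sum_{l=0}^k c_\beta^{r,i}(k,l)\otimes v_l .$$ Then: (0) For all $\alpha,\beta\in\Bbbk^*$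 and $r,i\in\mathbb Z$ with $\alpha^w=\beta^n$, $V(\alpha,\beta,x^rg^i)$ is a simple Yetter–Drinfeld module over $H$, of dimension $n+1-\phi(-i-j)$ if $\beta=\gamma^j$ for an integer $j$, and of dimension $n$ if $\beta^n\ne1$. (1) Every simple Yetter–Drinfeld module over $H$ (of arbitrary dimension) is isomorphic to $V(\alpha,\beta,x^rg^i)$ for some $\alpha,\beta\in\Bbbk^*$ and $r,i\in\mathbb Z$ with $\alpha^w=\beta^n$. (2) Two such modules $V(\alpha,\beta,x^rg^i)$ and $V(\alpha',\beta',x^{r'}g^{i'})$ are isomorphic if and only if $\alpha=\alpha'$, $\beta=\beta'$ and $x^rg^i=x^{r'}g^{i'}$ in $H$. -/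

import Mathlib

open scoped TensorProduct


/-! ## Yetter–Drinfeld modules over a Hopf algebra -/

section YetterDrinfeld

universe u v v' x

/-- The data of a left action and a left coaction of `H` on the `k`-vector space `V`:
a `k`-linear left `H`-module structure `H → End(V)` and a linear map `V → H ⊗ V`. -/
structure ActionCoaction (k : Type u) (H : Type x) (V : Type v) [Field k] [Ring H] [Algebra k H]
    [AddCommGroup V] [Module k V] where
  /-- the action `h ↦ (v ↦ h · v)` -/
  act : H →ₐ[k] Module.End k V
  /-- the coaction `δ` -/
  coact : V →ₗ[k] H ⊗[k] V

/-- For a left action of `H` on `V`, the linear map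
`a ⊗ (b ⊗ c) ↦ (u ⊗ v ↦ a u S(c) ⊗ b · v)`. -/
noncomputable def ydTwist (k : Type u) {H : Type x} {V : Type v} [Field k] [Ring H]
    [HopfAlgebra k H] [AddCommGroup V] [Module k V] (act : H →ₐ[k] Module.End k V) :
    H ⊗[k] (H ⊗[k] H) →ₗ[k] (H ⊗[k] V →ₗ[k] H ⊗[k] V) :=
  TensorProduct.lift <| LinearMap.mk₂ k
    (fun (a : H) (t : H ⊗[k] H) =>
      LinearMap.rTensor V (LinearMap.mul k H a) ∘ₗ
        TensorProduct.lift (LinearMap.mk₂ k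
          (fun (b c : H) => TensorProduct.map
            (LinearMap.mulRight k (HopfAlgebra.antipode k c)) (act b))
          (fun b b' c => by simp [TensorProduct.map_add_right])
          (fun s b c => by simp [TensorProduct.map_smul_right])
          (fun b c c' => by
            ext; simp [mul_add, TensorProduct.add_tmul])
          (fun s b c => by
            ext; simp [TensorProduct.smul_tmul'])) t)
    (fun a a' t => by simp [LinearMap.rTensor_add, LinearMap.add_comp])
    (fun s a t => by simp [LinearMap.rTensor_smul, LinearMap.smul_comp])
    (fun a t t' => by simp [LinearMap.comp_add])
    (fun s a t => by simp [LinearMap.comp_smul])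

theorem ydTwist_tmul (k : Type u) {H : Type x} {V : Type v} [Field k] [Ring H]
    [HopfAlgebra k H] [AddCommGroup V] [Module k V] (act : H →ₐ[k] Module.End k V)
    (a b c u : H) (v : V) :
    ydTwist k act (a ⊗ₜ[k] (b ⊗ₜ[k] c)) (u ⊗ₜ[k] v) =
      (a * u * HopfAlgebra.antipode k c) ⊗ₜ[k] act b v := by
  simp [ydTwist, mul_assoc]

namespace ActionCoaction

variable {k : Type u} {H : Type x} {V : Type v} {W : Type v'} [Field k] [Ring H] [HopfAlgebra k H]
  [AddCommGroup V] [Module k V] [AddCommGroup W] [Module k W]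

/-- `(V, ·, δ)` is a (left-left) Yetter–Drinfeld module over `H`. -/
structure IsYetterDrinfeld (M : ActionCoaction k H V) : Prop where
  /-- `(Δ ⊗ id) δ = (id ⊗ δ) δ` -/
  coassoc : ∀ v : V,
    TensorProduct.assoc k H H V
        (LinearMap.rTensor V (Coalgebra.comul : H →ₗ[k] H ⊗[k] H) (M.coact v)) =
      LinearMap.lTensor H M.coact (M.coact v)
  /-- `(ε ⊗ id) δ = id` -/
  counit_coact : ∀ v : V,
    TensorProduct.lid k V
      (LinearMap.rTensor V (Coalgebra.counit : H →ₗ[k] k) (M.coact v)) = v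
  /-- `δ(h · v) = h₍₁₎ v₍₋₁₎ S(h₍₃₎) ⊗ h₍₂₎ · v₍₀₎` -/
  compat : ∀ (h : H) (v : V),
    M.coact (M.act h v) =
      ydTwist k M.act
        (LinearMap.lTensor H (Coalgebra.comul : H →ₗ[k] H ⊗[k] H) (Coalgebra.comul h))
        (M.coact v)

/-- The subspace `W` is a submodule and a subcomodule, `δ(W) ⊆ H ⊗ W`. -/
def IsSubobject (M : ActionCoaction k H V) (W : Submodule k V) : Prop :=
  (∀ (h : H), ∀ v ∈ W, M.act h v ∈ W) ∧
    ∀ v ∈ W, M.coact v ∈ LinearMap.range (LinearMap.lTensor H W.subtype)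

/-- `V` is a simple Yetter–Drinfeld module: it is a nonzero Yetter–Drinfeld module without proper
nonzero Yetter–Drinfeld submodules. -/
structure IsSimpleYetterDrinfeld (M : ActionCoaction k H V) : Prop where
  isYetterDrinfeld : M.IsYetterDrinfeld
  nontrivial : Nontrivial V
  eq_bot_or_eq_top : ∀ W : Submodule k V, M.IsSubobject W → W = ⊥ ∨ W = ⊤

/-- An isomorphism: a linear bijection preserving the action and the coaction. -/
def Isomorphic (M : ActionCoaction k H V) (N : ActionCoaction k H W) : Prop :=
  ∃ e : V ≃ₗ[k] W, (∀ (h : H) (v : V), e (M.act h v) = N.act h (e v)) ∧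
    ∀ v : V, N.coact (e v) = LinearMap.lTensor H e.toLinearMap (M.coact v)

end ActionCoaction

end YetterDrinfeld

/-! ## Powers of sums of `q`-commuting elements -/

section QBinomial

/-- The Gaussian binomial coefficient `[i + j choose j]` at `q`. -/
def qBinomAux {k : Type*} [Field k] (q : k) : ℕ → ℕ → k
  | _, 0 => 1
  | 0, _ + 1 => 1
  | i + 1, j + 1 => qBinomAux q i (j + 1) + q ^ (i + 1) * qBinomAux q (i + 1) j

theorem qBinomAux_zero_right {k : Type*} [Field k] (q : k) (i : ℕ) : qBinomAux q i 0 = 1 := by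
  cases i <;> simp [qBinomAux]

theorem qBinomAux_zero_left {k : Type*} [Field k] (q : k) (j : ℕ) : qBinomAux q 0 j = 1 := by
  cases j <;> simp [qBinomAux]

theorem qBinomAux_succ_succ {k : Type*} [Field k] (q : k) (i j : ℕ) :
    qBinomAux q (i + 1) (j + 1) = qBinomAux q i (j + 1) + q ^ (i + 1) * qBinomAux q (i + 1) j := by
  rw [qBinomAux]

theorem qBinomAux_identity {k : Type*} [Field k] (q : k) (i j : ℕ) :
    (1 - q ^ (j + 1)) * qBinomAux q i (j + 1) = (1 - q ^ (i + 1)) * qBinomAux q (i + 1) j := by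
  induction i generalizing j with
  | zero =>
    induction j with
    | zero => simp [qBinomAux]
    | succ j ih =>
      simp only [qBinomAux, zero_add, pow_one, mul_one] at ih ⊢
      rw [mul_add, mul_one, mul_left_comm, ← ih]; ring
  | succ i ih =>
    induction j with
    | zero =>
      have h := ih 0
      simp only [qBinomAux, qBinomAux_zero_right, zero_add, pow_one, mul_one] at h ⊢
      rw [mul_add, h]; ring
    | succ j ih' =>
      rw [qBinomAux_succ_succ q i (j + 1), qBinomAux_succ_succ q (i + 1) j,
        mul_add, mul_add, ih (j + 1), mul_left_comm (1 - q ^ (i + 1 + 1)), ← ih']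
      ring

theorem qBinomAux_eq_zero {k : Type*} [Field k] {q : k} {n : ℕ} (hq : IsPrimitiveRoot q n)
    (j i : ℕ) (hi : 0 < i) (hn : i + (j + 1) = n) : qBinomAux q i (j + 1) = 0 := by
  have hne : 1 - q ^ (j + 1) ≠ 0 := fun h =>
    hq.pow_ne_one_of_pos_of_lt (by omega) (by omega) (sub_eq_zero.mp h).symm
  have h := qBinomAux_identity q i j
  induction j generalizing i with
  | zero =>
    have h1 : 1 - q ^ (i + 1) = 0 := by rw [show i + 1 = n by omega, hq.pow_eq_one, sub_self]
    rw [h1, zero_mul] at h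
    exact (mul_eq_zero.mp h).resolve_left hne
  | succ j ih =>
    have h0 : qBinomAux q (i + 1) (j + 1) = 0 :=
      ih (i + 1) (by omega) (by omega)
        (fun h => hq.pow_ne_one_of_pos_of_lt (by omega) (by omega) (sub_eq_zero.mp h).symm)
        (qBinomAux_identity q (i + 1) j)
    rw [h0, mul_zero] at h
    exact (mul_eq_zero.mp h).resolve_left hne

theorem qcomm_mul_pow {k R : Type*} [Field k] [Ring R] [Algebra k R] (q : k) (a b : R)
    (h : b * a = q • (a * b)) (i : ℕ) : b * a ^ i = q ^ i • (a ^ i * b) := by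
  induction i with
  | zero => simp
  | succ i ih =>
    rw [pow_succ, ← mul_assoc, ih, smul_mul_assoc, mul_assoc, h, mul_smul_comm, smul_smul,
      mul_assoc, pow_succ]

theorem qcomm_pow_mul {k R : Type*} [Field k] [Ring R] [Algebra k R] (q : k) (a b : R)
    (h : b * a = q • (a * b)) (i : ℕ) : b ^ i * a = q ^ i • (a * b ^ i) := by
  induction i with
  | zero => simp
  | succ i ih =>
    rw [pow_succ, mul_assoc, h, mul_smul_comm, ← mul_assoc, ih, smul_mul_assoc, smul_smul,
      mul_assoc, pow_succ']

theorem qBinom_add_pow {k R : Type*} [Field k] [Ring R] [Algebra k R] (q : k) (a b : R)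
    (h : b * a = q • (a * b)) (N : ℕ) :
    (a + b) ^ N =
      ∑ p ∈ Finset.HasAntidiagonal.antidiagonal N, qBinomAux q p.1 p.2 • (a ^ p.1 * b ^ p.2) := by
  induction N with
  | zero => simp [qBinomAux]
  | succ N ih =>
    have hA : ∀ N : ℕ, ∑ p ∈ Finset.HasAntidiagonal.antidiagonal (N + 1), qBinomAux q p.1 p.2 • (a ^ p.1 * b ^ p.2)
        = ∑ p ∈ Finset.HasAntidiagonal.antidiagonal N, qBinomAux q p.1 p.2 • (a ^ (p.1 + 1) * b ^ p.2)
          + ∑ p ∈ Finset.HasAntidiagonal.antidiagonal N,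
              (q ^ p.1 * qBinomAux q p.1 p.2) • (a ^ p.1 * b ^ (p.2 + 1)) := by
      intro N
      cases N with
      | zero => simp [qBinomAux, Finset.Nat.antidiagonal_succ, add_comm]
      | succ N =>
        rw [Finset.Nat.sum_antidiagonal_succ (n := N + 1),
          Finset.Nat.sum_antidiagonal_succ' (n := N)]
        rw [Finset.Nat.sum_antidiagonal_succ' (n := N)
          (f := fun p => qBinomAux q p.1 p.2 • (a ^ (p.1 + 1) * b ^ p.2))]
        rw [Finset.Nat.sum_antidiagonal_succ (n := N)
          (f := fun p => (q ^ p.1 * qBinomAux q p.1 p.2) • (a ^ p.1 * b ^ (p.2 + 1)))]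
        simp only [qBinomAux, add_smul, Finset.sum_add_distrib, qBinomAux_zero_right,
          qBinomAux_zero_left, pow_zero, one_mul, mul_one, one_smul]
        abel
    rw [pow_succ', ih, hA, add_mul, Finset.mul_sum, Finset.mul_sum]
    congr 1
    · refine Finset.sum_congr rfl fun p _ => ?_
      rw [mul_smul_comm, ← mul_assoc, pow_succ']
    · refine Finset.sum_congr rfl fun p _ => ?_
      rw [mul_smul_comm, ← mul_assoc, qcomm_mul_pow q a b h, smul_mul_assoc, smul_smul,
        mul_assoc, ← pow_succ', mul_comm]

theorem qcomm_add_pow_eq {k R : Type*} [Field k] [Ring R] [Algebra k R] {q : k} {n : ℕ}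
    (hn : n ≠ 0) (hq : IsPrimitiveRoot q n) (a b : R) (h : b * a = q • (a * b)) :
    (a + b) ^ n = a ^ n + b ^ n := by
  rw [qBinom_add_pow q a b h]
  obtain ⟨m, rfl⟩ := Nat.exists_eq_succ_of_ne_zero hn
  cases m with
  | zero => simp [qBinomAux, Finset.Nat.antidiagonal_succ, add_comm]
  | succ m =>
    rw [Nat.succ_eq_add_one, Finset.Nat.sum_antidiagonal_succ (n := m + 1),
      Finset.Nat.sum_antidiagonal_succ' (n := m)]
    rw [Finset.sum_eq_zero]
    · simp [qBinomAux_zero_right, qBinomAux_zero_left, add_comm]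
    · intro p hp
      rw [Finset.HasAntidiagonal.mem_antidiagonal] at hp
      rw [qBinomAux_eq_zero hq p.2 (p.1 + 1) (by omega) (by omega), zero_smul]

theorem neg_qcomm_mul_pow {k R : Type*} [Field k] [Ring R] [Algebra k R] {q : k} {n : ℕ}
    (hn : n ≠ 0) (hq : IsPrimitiveRoot q n) (a b : R) (h : b * a = q • (a * b)) :
    (-(a * b)) ^ n = -(a ^ n * b ^ n) := by
  have key : ∀ N : ℕ, (a * b) ^ N = q ^ (∑ i ∈ Finset.range N, i) • (a ^ N * b ^ N) := by
    intro N
    induction N with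
    | zero => simp
    | succ N ih =>
      rw [pow_succ, ih, Finset.sum_range_succ, smul_mul_assoc, mul_assoc, ← mul_assoc (b ^ N),
        qcomm_pow_mul q a b h, smul_mul_assoc, mul_smul_comm, smul_smul, ← pow_add, mul_assoc,
        ← pow_succ, ← mul_assoc, ← pow_succ]
  have hsum := Finset.sum_range_id_mul_two n
  rw [neg_pow, key]
  rcases Nat.even_or_odd n with he | ho
  · obtain ⟨m, rfl⟩ := he
    have hm : q ^ m = -1 := by
      have h1 : q ^ m * q ^ m = 1 := by rw [← pow_add, hq.pow_eq_one]
      rcases mul_self_eq_one_iff.mp h1 with h2 | h2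
      · exact absurd h2 (hq.pow_ne_one_of_pos_of_lt (by omega) (by omega))
      · exact h2
    have hS : ∑ i ∈ Finset.range (m + m), i = m * (m + m - 1) := by
      have : (m + m) * (m + m - 1) = (m * (m + m - 1)) * 2 := by ring
      omega
    have hodd : Odd (m + m - 1) := ⟨m - 1, by omega⟩
    rw [hS, pow_mul, hm, hodd.neg_one_pow, (Even.neg_one_pow ⟨m, rfl⟩), one_mul, neg_smul,
      one_smul]
  · obtain ⟨m, rfl⟩ := ho
    have hS : ∑ i ∈ Finset.range (2 * m + 1), i = (2 * m + 1) * m := by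
      have : (2 * m + 1) * (2 * m + 1 - 1) = ((2 * m + 1) * m) * 2 := by
        rw [Nat.add_sub_cancel]; ring
      omega
    rw [hS, pow_mul, hq.pow_eq_one, one_pow, one_smul, (Odd.neg_one_pow ⟨m, rfl⟩), neg_one_mul]

end QBinomial

/-! ## Generalized Liu algebras -/

section LiuAlgebra

universe u

/-- The generators `x`, `x⁻¹`, `g`, `y`. -/
inductive LiuGen : Type
  | x | xinv | g | y

/-- The defining relations of the generalized Liu algebra `B(n, w, γ)`. -/
inductive LiuRel {k : Type u} [Field k] (n w : ℕ) (γ : k) :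
    FreeAlgebra k LiuGen → FreeAlgebra k LiuGen → Prop
  | x_xinv : LiuRel n w γ (FreeAlgebra.ι k LiuGen.x * FreeAlgebra.ι k LiuGen.xinv) 1
  | xinv_x : LiuRel n w γ (FreeAlgebra.ι k LiuGen.xinv * FreeAlgebra.ι k LiuGen.x) 1
  | x_g : LiuRel n w γ (FreeAlgebra.ι k LiuGen.x * FreeAlgebra.ι k LiuGen.g)
      (FreeAlgebra.ι k LiuGen.g * FreeAlgebra.ι k LiuGen.x)
  | x_y : LiuRel n w γ (FreeAlgebra.ι k LiuGen.x * FreeAlgebra.ι k LiuGen.y)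
      (FreeAlgebra.ι k LiuGen.y * FreeAlgebra.ι k LiuGen.x)
  | y_g : LiuRel n w γ (FreeAlgebra.ι k LiuGen.y * FreeAlgebra.ι k LiuGen.g)
      (γ • (FreeAlgebra.ι k LiuGen.g * FreeAlgebra.ι k LiuGen.y))
  | y_pow : LiuRel n w γ (FreeAlgebra.ι k LiuGen.y ^ n) (1 - FreeAlgebra.ι k LiuGen.x ^ w)
  | x_pow : LiuRel n w γ (1 - FreeAlgebra.ι k LiuGen.x ^ w) (1 - FreeAlgebra.ι k LiuGen.g ^ n)

/-- The algebra `B(n, w, γ)` generated by `x^{±1}, g, y` subject to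
`x x⁻¹ = x⁻¹ x = 1`, `xg = gx`, `xy = yx`, `yg = γ gy`, `yⁿ = 1 - x^w = 1 - gⁿ`. -/
def LiuAlgebra {k : Type u} [Field k] (n w : ℕ) (γ : k) : Type u := RingQuot (LiuRel n w γ)

namespace LiuAlgebra

variable {k : Type u} [Field k] (n w : ℕ) (γ : k)

noncomputable instance : Ring (LiuAlgebra n w γ) := inferInstanceAs (Ring (RingQuot _))

noncomputable instance : Algebra k (LiuAlgebra n w γ) :=
  inferInstanceAs (Algebra k (RingQuot (LiuRel n w γ)))

/-- The quotient map from the free algebra. -/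
noncomputable def mk : FreeAlgebra k LiuGen →ₐ[k] LiuAlgebra n w γ :=
  RingQuot.mkAlgHom k (LiuRel n w γ)

/-- The generator `x`. -/
noncomputable def x : LiuAlgebra n w γ := mk n w γ (FreeAlgebra.ι k LiuGen.x)
/-- The generator `x⁻¹`. -/
noncomputable def xinv : LiuAlgebra n w γ := mk n w γ (FreeAlgebra.ι k LiuGen.xinv)
/-- The generator `g`. -/
noncomputable def g : LiuAlgebra n w γ := mk n w γ (FreeAlgebra.ι k LiuGen.g)
/-- The generator `y`. -/
noncomputable def y : LiuAlgebra n w γ := mk n w γ (FreeAlgebra.ι k LiuGen.y)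

theorem mk_rel {a b : FreeAlgebra k LiuGen} (h : LiuRel n w γ a b) :
    mk n w γ a = mk n w γ b := RingQuot.mkAlgHom_rel k h

theorem x_mul_xinv : x n w γ * xinv n w γ = 1 := by
  simpa [x, xinv] using mk_rel n w γ .x_xinv
theorem xinv_mul_x : xinv n w γ * x n w γ = 1 := by
  simpa [x, xinv] using mk_rel n w γ .xinv_x
theorem x_mul_g : x n w γ * g n w γ = g n w γ * x n w γ := by
  simpa [x, g] using mk_rel n w γ .x_g
theorem x_mul_y : x n w γ * y n w γ = y n w γ * x n w γ := by
  simpa [x, y] using mk_rel n w γ .x_y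
theorem y_mul_g : y n w γ * g n w γ = γ • (g n w γ * y n w γ) := by
  simpa [y, g] using mk_rel n w γ .y_g
theorem y_pow : y n w γ ^ n = 1 - x n w γ ^ w := by
  simpa [x, y] using mk_rel n w γ .y_pow
theorem g_pow : g n w γ ^ n = x n w γ ^ w := by
  simpa [x, g] using (mk_rel n w γ .x_pow).symm

variable {n w γ}

/-- The universal property of `B(n, w, γ)`. -/
noncomputable def lift {B : Type*} [Ring B] [Algebra k B] (X X' G Y : B)
    (h1 : X * X' = 1) (h2 : X' * X = 1) (h3 : X * G = G * X) (h4 : X * Y = Y * X)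
    (h5 : Y * G = γ • (G * Y)) (h6 : Y ^ n = 1 - X ^ w) (h7 : X ^ w = G ^ n) :
    LiuAlgebra n w γ →ₐ[k] B :=
  RingQuot.liftAlgHom k
    ⟨FreeAlgebra.lift k (fun | .x => X | .xinv => X' | .g => G | .y => Y), by
      intro a b hab
      cases hab <;> simp [h1, h2, h3, h4, h5, h6, h7]⟩

section lift

variable {B : Type*} [Ring B] [Algebra k B] (X X' G Y : B)
    (h1 : X * X' = 1) (h2 : X' * X = 1) (h3 : X * G = G * X) (h4 : X * Y = Y * X)
    (h5 : Y * G = γ • (G * Y)) (h6 : Y ^ n = 1 - X ^ w) (h7 : X ^ w = G ^ n)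

theorem lift_x : lift X X' G Y h1 h2 h3 h4 h5 h6 h7 (x n w γ) = X :=
  (RingQuot.liftAlgHom_mkAlgHom_apply k _ _ _).trans (by simp)
theorem lift_xinv : lift X X' G Y h1 h2 h3 h4 h5 h6 h7 (xinv n w γ) = X' :=
  (RingQuot.liftAlgHom_mkAlgHom_apply k _ _ _).trans (by simp)
theorem lift_g : lift X X' G Y h1 h2 h3 h4 h5 h6 h7 (g n w γ) = G :=
  (RingQuot.liftAlgHom_mkAlgHom_apply k _ _ _).trans (by simp)
theorem lift_y : lift X X' G Y h1 h2 h3 h4 h5 h6 h7 (y n w γ) = Y :=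
  (RingQuot.liftAlgHom_mkAlgHom_apply k _ _ _).trans (by simp)

end lift

theorem induction {P : LiuAlgebra n w γ → Prop} (hc : ∀ c : k, P (algebraMap k _ c))
    (hx : P (x n w γ)) (hx' : P (xinv n w γ)) (hg : P (g n w γ)) (hy : P (y n w γ))
    (hadd : ∀ a b, P a → P b → P (a + b)) (hmul : ∀ a b, P a → P b → P (a * b))
    (a : LiuAlgebra n w γ) : P a := by
  obtain ⟨a, rfl⟩ := RingQuot.mkAlgHom_surjective k (LiuRel n w γ) a
  change P (mk n w γ a)
  induction a using FreeAlgebra.induction with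
  | grade0 r => rw [AlgHom.commutes]; exact hc r
  | grade1 s => cases s <;> assumption
  | mul a b ha hb => rw [map_mul]; exact hmul _ _ ha hb
  | add a b ha hb => rw [map_add]; exact hadd _ _ ha hb

theorem algHom_ext {B : Type*} [Ring B] [Algebra k B] {f f' : LiuAlgebra n w γ →ₐ[k] B}
    (hx : f (x n w γ) = f' (x n w γ)) (hx' : f (xinv n w γ) = f' (xinv n w γ))
    (hg : f (g n w γ) = f' (g n w γ)) (hy : f (y n w γ) = f' (y n w γ)) : f = f' := by
  refine AlgHom.ext fun a => ?_
  induction a using induction with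
  | hc c => rw [AlgHom.commutes, AlgHom.commutes]
  | hx => exact hx
  | hx' => exact hx'
  | hg => exact hg
  | hy => exact hy
  | hadd a b ha hb => rw [map_add, map_add, ha, hb]
  | hmul a b ha hb => rw [map_mul, map_mul, ha, hb]

variable (n w γ)

/-- `x` as a unit. -/
noncomputable def xUnit : (LiuAlgebra n w γ)ˣ :=
  ⟨x n w γ, xinv n w γ, x_mul_xinv n w γ, xinv_mul_x n w γ⟩

theorem commute_x_g : Commute (x n w γ) (g n w γ) := x_mul_g n w γ
theorem commute_xinv_g : Commute (xinv n w γ) (g n w γ) :=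
  Commute.units_inv_left (u := xUnit n w γ) (commute_x_g n w γ)
theorem commute_xinv_y : Commute (xinv n w γ) (y n w γ) :=
  Commute.units_inv_left (u := xUnit n w γ) (x_mul_y n w γ)

theorem x_pow_mul_xinv_pow : x n w γ ^ w * xinv n w γ ^ w = 1 :=
  ((show Commute (x n w γ) (xinv n w γ) from
    (x_mul_xinv n w γ).trans (xinv_mul_x n w γ).symm).mul_pow w).symm.trans
      (by rw [x_mul_xinv, one_pow])

variable [NeZero n]

/-- `g` as a unit: `g⁻¹ = g^{n-1} x^{-w}`. -/
noncomputable def gUnit : (LiuAlgebra n w γ)ˣ where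
  val := g n w γ
  inv := g n w γ ^ (n - 1) * xinv n w γ ^ w
  val_inv := by
    rw [← mul_assoc, ← pow_succ', Nat.sub_add_cancel (NeZero.one_le), g_pow, x_pow_mul_xinv_pow]
  inv_val := by
    rw [mul_assoc, ((commute_xinv_g n w γ).pow_left w).eq, ← mul_assoc, ← pow_succ,
      Nat.sub_add_cancel (NeZero.one_le), g_pow, x_pow_mul_xinv_pow]

/-- The group-like element `x^r g^i`, for integers `r` and `i`. -/
noncomputable def xg (r i : ℤ) : LiuAlgebra n w γ :=
  ((xUnit n w γ ^ r * gUnit n w γ ^ i : (LiuAlgebra n w γ)ˣ) : LiuAlgebra n w γ)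

/-- The element `g⁻¹`. -/
noncomputable def ginv : LiuAlgebra n w γ := ((gUnit n w γ)⁻¹ : (LiuAlgebra n w γ)ˣ)

theorem g_mul_ginv : g n w γ * ginv n w γ = 1 := (gUnit n w γ).mul_inv
theorem ginv_mul_g : ginv n w γ * g n w γ = 1 := (gUnit n w γ).inv_mul

theorem commute_xinv_ginv : Commute (xinv n w γ) (ginv n w γ) :=
  Commute.units_inv_right (u := gUnit n w γ) (commute_xinv_g n w γ)

theorem ginv_mul_y : ginv n w γ * y n w γ = γ • (y n w γ * ginv n w γ) := by
  calc ginv n w γ * y n w γ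
      = ginv n w γ * (y n w γ * g n w γ) * ginv n w γ := by
        rw [mul_assoc, mul_assoc, g_mul_ginv, mul_one]
    _ = γ • (y n w γ * ginv n w γ) := by
        rw [y_mul_g, mul_smul_comm, smul_mul_assoc, ← mul_assoc, ginv_mul_g, one_mul]

theorem ginv_pow : ginv n w γ ^ n = xinv n w γ ^ w := by
  have h : g n w γ ^ n * ginv n w γ ^ n = 1 :=
    ((show Commute (g n w γ) (ginv n w γ) from
      (g_mul_ginv n w γ).trans (ginv_mul_g n w γ).symm).mul_pow n).symm.trans
        (by rw [g_mul_ginv, one_pow])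
  have h' : xinv n w γ ^ w * x n w γ ^ w = 1 :=
    ((show Commute (xinv n w γ) (x n w γ) from
    (xinv_mul_x n w γ).trans (x_mul_xinv n w γ).symm).mul_pow w).symm.trans
      (by rw [xinv_mul_x, one_pow])
  rw [g_pow] at h
  exact (left_inv_eq_right_inv h' h).symm

variable [hγ : Fact (IsPrimitiveRoot γ n)]

theorem comul_rel_one : (x n w γ ⊗ₜ[k] x n w γ) * (xinv n w γ ⊗ₜ[k] xinv n w γ) = 1 := by
  simp [x_mul_xinv, Algebra.TensorProduct.one_def]

theorem comul_rel_two : (xinv n w γ ⊗ₜ[k] xinv n w γ) * (x n w γ ⊗ₜ[k] x n w γ) = 1 := by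
  simp [xinv_mul_x, Algebra.TensorProduct.one_def]

theorem comul_rel_three : (x n w γ ⊗ₜ[k] x n w γ) * (g n w γ ⊗ₜ[k] g n w γ) =
    (g n w γ ⊗ₜ[k] g n w γ) * (x n w γ ⊗ₜ[k] x n w γ) := by
  simp [x_mul_g]

theorem comul_rel_four :
    (x n w γ ⊗ₜ[k] x n w γ) * (y n w γ ⊗ₜ[k] g n w γ + 1 ⊗ₜ[k] y n w γ) =
    (y n w γ ⊗ₜ[k] g n w γ + 1 ⊗ₜ[k] y n w γ) * (x n w γ ⊗ₜ[k] x n w γ) := by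
  simp [mul_add, add_mul, x_mul_g, x_mul_y]

theorem comul_rel_five :
    (y n w γ ⊗ₜ[k] g n w γ + 1 ⊗ₜ[k] y n w γ) * (g n w γ ⊗ₜ[k] g n w γ) =
    γ • ((g n w γ ⊗ₜ[k] g n w γ) * (y n w γ ⊗ₜ[k] g n w γ + 1 ⊗ₜ[k] y n w γ)) := by
  simp [mul_add, add_mul, y_mul_g, TensorProduct.smul_tmul']

theorem comul_rel_six :
    (y n w γ ⊗ₜ[k] g n w γ + 1 ⊗ₜ[k] y n w γ) ^ n = 1 - (x n w γ ⊗ₜ[k] x n w γ) ^ w := by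
  rw [qcomm_add_pow_eq (NeZero.ne n) hγ.out]
  · simp only [Algebra.TensorProduct.tmul_pow, one_pow, y_pow, g_pow,
      TensorProduct.sub_tmul, TensorProduct.tmul_sub, Algebra.TensorProduct.one_def]
    abel
  · simp [y_mul_g]

theorem comul_rel_seven : (x n w γ ⊗ₜ[k] x n w γ) ^ w = (g n w γ ⊗ₜ[k] g n w γ) ^ n := by
  simp [Algebra.TensorProduct.tmul_pow, g_pow]

/-- `Δ(x) = x ⊗ x`, `Δ(g) = g ⊗ g`, `Δ(y) = y ⊗ g + 1 ⊗ y`. -/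
noncomputable def comulHom :
    LiuAlgebra n w γ →ₐ[k] LiuAlgebra n w γ ⊗[k] LiuAlgebra n w γ :=
  lift (x n w γ ⊗ₜ x n w γ) (xinv n w γ ⊗ₜ xinv n w γ) (g n w γ ⊗ₜ g n w γ)
    (y n w γ ⊗ₜ g n w γ + 1 ⊗ₜ y n w γ)
    (comul_rel_one n w γ) (comul_rel_two n w γ) (comul_rel_three n w γ) (comul_rel_four n w γ)
    (comul_rel_five n w γ) (comul_rel_six n w γ) (comul_rel_seven n w γ)

/-- `ε(x) = 1`, `ε(g) = 1`, `ε(y) = 0`. -/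
noncomputable def counitHom : LiuAlgebra n w γ →ₐ[k] k :=
  lift 1 1 1 0 (by simp) (by simp) (by simp) (by simp) (by simp) (by simp [NeZero.ne n]) (by simp)

/-- `S(x) = x⁻¹`, `S(g) = g⁻¹`, `S(y) = -y g⁻¹`, extended as an algebra anti-homomorphism. -/
noncomputable def antipodeHom : LiuAlgebra n w γ →ₐ[k] (LiuAlgebra n w γ)ᵐᵒᵖ :=
  lift (.op (xinv n w γ)) (.op (x n w γ)) (.op (ginv n w γ)) (.op (-(y n w γ * ginv n w γ)))
    (by rw [← MulOpposite.op_mul, x_mul_xinv, MulOpposite.op_one])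
    (by rw [← MulOpposite.op_mul, xinv_mul_x, MulOpposite.op_one])
    (by rw [← MulOpposite.op_mul, ← MulOpposite.op_mul, (commute_xinv_ginv n w γ).eq])
    (by
      rw [← MulOpposite.op_mul, ← MulOpposite.op_mul,
        (((commute_xinv_y n w γ).mul_right (commute_xinv_ginv n w γ)).neg_right).eq])
    (by
      rw [← MulOpposite.op_mul, ← MulOpposite.op_mul, ← MulOpposite.op_smul, mul_neg, neg_mul,
        ← mul_assoc, ginv_mul_y, smul_neg, smul_mul_assoc])
    (by
      rw [← MulOpposite.op_pow, ← MulOpposite.op_pow, ← MulOpposite.op_one, ← MulOpposite.op_sub,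
        neg_qcomm_mul_pow (NeZero.ne n) hγ.out _ _ (ginv_mul_y n w γ), ginv_pow, y_pow, sub_mul,
        one_mul, x_pow_mul_xinv_pow, neg_sub])
    (by rw [← MulOpposite.op_pow, ← MulOpposite.op_pow, ginv_pow])

theorem comulHom_x : comulHom n w γ (x n w γ) = x n w γ ⊗ₜ x n w γ := by
  rw [comulHom, lift_x]
theorem comulHom_xinv : comulHom n w γ (xinv n w γ) = xinv n w γ ⊗ₜ xinv n w γ := by
  rw [comulHom, lift_xinv]
theorem comulHom_g : comulHom n w γ (g n w γ) = g n w γ ⊗ₜ g n w γ := by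
  rw [comulHom, lift_g]
theorem comulHom_y : comulHom n w γ (y n w γ) = y n w γ ⊗ₜ g n w γ + 1 ⊗ₜ y n w γ := by
  rw [comulHom, lift_y]
theorem counitHom_x : counitHom n w γ (x n w γ) = 1 := by
  rw [counitHom, lift_x]
theorem counitHom_xinv : counitHom n w γ (xinv n w γ) = 1 := by
  rw [counitHom, lift_xinv]
theorem counitHom_g : counitHom n w γ (g n w γ) = 1 := by
  rw [counitHom, lift_g]
theorem counitHom_y : counitHom n w γ (y n w γ) = 0 := by
  rw [counitHom, lift_y]
theorem antipodeHom_x : antipodeHom n w γ (x n w γ) = .op (xinv n w γ) := by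
  rw [antipodeHom, lift_x]
theorem antipodeHom_xinv : antipodeHom n w γ (xinv n w γ) = .op (x n w γ) := by
  rw [antipodeHom, lift_xinv]
theorem antipodeHom_g : antipodeHom n w γ (g n w γ) = .op (ginv n w γ) := by
  rw [antipodeHom, lift_g]
theorem antipodeHom_y : antipodeHom n w γ (y n w γ) = .op (-(y n w γ * ginv n w γ)) := by
  rw [antipodeHom, lift_y]

noncomputable instance : Bialgebra k (LiuAlgebra n w γ) :=
  Bialgebra.ofAlgHom (comulHom n w γ) (counitHom n w γ)
    (algHom_ext (by simp [comulHom_x]) (by simp [comulHom_xinv]) (by simp [comulHom_g])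
      (by simp [comulHom_y, comulHom_g, TensorProduct.tmul_add, TensorProduct.add_tmul,
            Algebra.TensorProduct.one_def, add_assoc]))
    (algHom_ext (by simp [comulHom_x, counitHom_x]) (by simp [comulHom_xinv, counitHom_xinv])
      (by simp [comulHom_g, counitHom_g]) (by simp [comulHom_y, counitHom_y]))
    (algHom_ext (by simp [comulHom_x, counitHom_x]) (by simp [comulHom_xinv, counitHom_xinv])
      (by simp [comulHom_g, counitHom_g]) (by simp [comulHom_y, counitHom_y, counitHom_g]))

theorem comul_eq (a : LiuAlgebra n w γ) : Coalgebra.comul (R := k) a = comulHom n w γ a := rfl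
theorem counit_eq (a : LiuAlgebra n w γ) : Coalgebra.counit (R := k) a = counitHom n w γ a := rfl

/-- The antipode as a linear map. -/
noncomputable def antipodeLin : LiuAlgebra n w γ →ₗ[k] LiuAlgebra n w γ :=
  (MulOpposite.opLinearEquiv k).symm.toLinearMap ∘ₗ (antipodeHom n w γ).toLinearMap

theorem antipodeLin_apply (a : LiuAlgebra n w γ) :
    antipodeLin n w γ a = (antipodeHom n w γ a).unop := rfl

theorem antipodeLin_mul (a b : LiuAlgebra n w γ) :
    antipodeLin n w γ (a * b) = antipodeLin n w γ b * antipodeLin n w γ a := by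
  simp [antipodeLin_apply]

theorem mul_rTensor_mul (s t : LiuAlgebra n w γ ⊗[k] LiuAlgebra n w γ) (r : k)
    (hs : LinearMap.mul' k _ ((antipodeLin n w γ).rTensor _ s) = algebraMap k _ r) :
    LinearMap.mul' k _ ((antipodeLin n w γ).rTensor _ (s * t)) =
      r • LinearMap.mul' k _ ((antipodeLin n w γ).rTensor _ t) := by
  induction t with
  | zero => simp
  | add t t' ht ht' => rw [mul_add, map_add, map_add, ht, ht', map_add, map_add, smul_add]
  | tmul c d =>
    have key : LinearMap.mul' k _ ((antipodeLin n w γ).rTensor _ (s * (c ⊗ₜ[k] d))) =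
        antipodeLin n w γ c * LinearMap.mul' k _ ((antipodeLin n w γ).rTensor _ s) * d := by
      clear hs
      induction s with
      | zero => simp
      | add s s' h h' => rw [add_mul, map_add, map_add, h, h', map_add, map_add, mul_add, add_mul]
      | tmul p q => simp [antipodeLin_mul, mul_assoc]
    rw [key, hs, ← Algebra.commutes, ← Algebra.smul_def, smul_mul_assoc]
    simp

theorem mul_lTensor_mul (s t : LiuAlgebra n w γ ⊗[k] LiuAlgebra n w γ) (r : k)
    (ht : LinearMap.mul' k _ ((antipodeLin n w γ).lTensor _ t) = algebraMap k _ r) :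
    LinearMap.mul' k _ ((antipodeLin n w γ).lTensor _ (s * t)) =
      r • LinearMap.mul' k _ ((antipodeLin n w γ).lTensor _ s) := by
  induction s with
  | zero => simp
  | add t t' h h' => rw [add_mul, map_add, map_add, h, h', map_add, map_add, smul_add]
  | tmul c d =>
    have key : LinearMap.mul' k _ ((antipodeLin n w γ).lTensor _ ((c ⊗ₜ[k] d) * t)) =
        c * LinearMap.mul' k _ ((antipodeLin n w γ).lTensor _ t) * antipodeLin n w γ d := by
      clear ht
      induction t with
      | zero => simp
      | add s s' h h' => rw [mul_add, map_add, map_add, h, h', map_add, map_add, mul_add, add_mul]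
      | tmul p q => simp [antipodeLin_mul, mul_assoc]
    rw [key, ht, ← Algebra.commutes, ← Algebra.smul_def, smul_mul_assoc]
    simp

noncomputable instance : HopfAlgebra k (LiuAlgebra n w γ) where
  antipode := antipodeLin n w γ
  mul_antipode_rTensor_comul := by
    refine LinearMap.ext fun a => ?_
    simp only [LinearMap.comp_apply, Algebra.linearMap_apply, comul_eq, counit_eq]
    induction a using induction with
    | hc c => simp [Algebra.TensorProduct.algebraMap_apply, antipodeLin_apply]
    | hx => simp [comulHom_x, counitHom_x, antipodeLin_apply, antipodeHom_x, xinv_mul_x]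
    | hx' => simp [comulHom_xinv, counitHom_xinv, antipodeLin_apply, antipodeHom_xinv, x_mul_xinv]
    | hg => simp [comulHom_g, counitHom_g, antipodeLin_apply, antipodeHom_g, ginv_mul_g]
    | hy => simp [comulHom_y, counitHom_y, antipodeLin_apply, antipodeHom_y, mul_assoc, ginv_mul_g]
    | hadd a b ha hb => simp only [map_add, ha, hb]
    | hmul a b ha hb =>
      rw [map_mul, mul_rTensor_mul n w γ _ _ _ ha, hb, map_mul, map_mul, Algebra.smul_def]
  mul_antipode_lTensor_comul := by
    refine LinearMap.ext fun a => ?_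
    simp only [LinearMap.comp_apply, Algebra.linearMap_apply, comul_eq, counit_eq]
    induction a using induction with
    | hc c => simp [Algebra.TensorProduct.algebraMap_apply, antipodeLin_apply]
    | hx => simp [comulHom_x, counitHom_x, antipodeLin_apply, antipodeHom_x, x_mul_xinv]
    | hx' => simp [comulHom_xinv, counitHom_xinv, antipodeLin_apply, antipodeHom_xinv, xinv_mul_x]
    | hg => simp [comulHom_g, counitHom_g, antipodeLin_apply, antipodeHom_g, g_mul_ginv]
    | hy => simp [comulHom_y, counitHom_y, antipodeLin_apply, antipodeHom_y, antipodeHom_g]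
    | hadd a b ha hb => simp only [map_add, ha, hb]
    | hmul a b ha hb =>
      rw [map_mul, mul_lTensor_mul n w γ _ _ _ hb, ha, map_mul, map_mul, Algebra.smul_def]
      exact Algebra.commutes _ _

/-! ### The modules `V(α, β, x^r g^i)` -/

/-- The elements `c_β^{r,i}(k, l)` of `B(n, w, γ)`, defined recursively by
`c(0, 0) = x^r g^i`, `c(k+1, 0) = c(k, 0) S(y) + β y c(k, 0) S(g)`,
`c(k+1, l) = c(k, l) S(y) + β γ^{-l} y c(k, l) S(g) + c(k, l-1) S(g)` for `0 < l < k + 1`, and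
`c(k+1, k+1) = c(k, k) S(g)`; moreover `c(k, l) = 0` for `l > k`. -/
noncomputable def coactionCoeff (β : kˣ) (r i : ℤ) : ℕ → ℕ → LiuAlgebra n w γ
  | 0, 0 => xg n w γ r i
  | 0, _ + 1 => 0
  | j + 1, 0 =>
      coactionCoeff β r i j 0 * HopfAlgebra.antipode k (y n w γ) +
        (β : k) • (y n w γ * coactionCoeff β r i j 0 * HopfAlgebra.antipode k (g n w γ))
  | j + 1, l + 1 =>
      if l + 1 < j + 1 then
        coactionCoeff β r i j (l + 1) * HopfAlgebra.antipode k (y n w γ) +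
          ((β : k) * γ ^ (-((l + 1 : ℕ) : ℤ))) •
            (y n w γ * coactionCoeff β r i j (l + 1) * HopfAlgebra.antipode k (g n w γ)) +
          coactionCoeff β r i j l * HopfAlgebra.antipode k (g n w γ)
      else if l + 1 = j + 1 then
        coactionCoeff β r i j j * HopfAlgebra.antipode k (g n w γ)
      else 0

end LiuAlgebra

/-- The integer `φ(a)`: the unique element of `{1, …, n}` congruent to `a` modulo `n`. -/
def liuPhi (n : ℕ) (a : ℤ) : ℕ := ((a - 1) % (n : ℤ)).toNat + 1

theorem liuPhi_unique (n : ℕ) [NeZero n] (a : ℤ) (t : ℕ) :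
    t = liuPhi n a ↔ 1 ≤ t ∧ t ≤ n ∧ a ≡ t [ZMOD n] := by
  have hn : (0 : ℤ) < n := by exact_mod_cast NeZero.pos n
  have h0 := Int.emod_nonneg (a - 1) hn.ne'
  have h1 := Int.emod_lt_of_pos (a - 1) hn
  have h2 : (a - 1) % (n : ℤ) ≡ a - 1 [ZMOD n] := Int.mod_modEq _ _
  constructor
  · rintro rfl
    unfold liuPhi
    refine ⟨by omega, by omega, ?_⟩
    rw [Nat.cast_add, Int.toNat_of_nonneg h0]
    simpa using (h2.add_right 1).symm
  · rintro ⟨ht1, ht2, ht⟩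
    have h3 : ((t : ℤ) - 1) % n = (a - 1) % n := (ht.sub_right 1).symm
    rw [Int.emod_eq_of_lt (by omega) (by omega)] at h3
    unfold liuPhi
    omega

/-- The largest index `m` of the basis `v₀, …, v_m` of `V(α, β, x^r g^i)`:
`m = n - φ(-i-j)` if `β = γ^j` for some integer `j`, and `m = n - 1` otherwise. -/
noncomputable def liuTop {k : Type u} [Field k] (n : ℕ) (γ : k) (β : kˣ) (i : ℤ) : ℕ :=
  open Classical in
  if h : ∃ j : ℤ, (β : k) = γ ^ j then n - liuPhi n (-i - h.choose) else n - 1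

namespace LiuAlgebra

variable {k : Type u} [Field k] (n w : ℕ) (γ : k)

section action

variable (m : ℕ)

/-- The operator `v_j ↦ β γ^{-j} v_j` on the space with basis `v₀, …, v_m`. -/
noncomputable def gAct (β : kˣ) : Module.End k (Fin (m + 1) → k) :=
  (Pi.basisFun k (Fin (m + 1))).constr k fun j =>
    ((β : k) * γ ^ (-((j : ℕ) : ℤ))) • Pi.single j 1

/-- The operator `v_j ↦ v_{j+1}` for `j < m`, `v_m ↦ (1 - βⁿ) v₀`. -/
noncomputable def yAct (β : kˣ) : Module.End k (Fin (m + 1) → k) :=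
  (Pi.basisFun k (Fin (m + 1))).constr k fun j =>
    if h : (j : ℕ) < m then Pi.single ⟨j + 1, by omega⟩ 1
    else (1 - (β : k) ^ n) • Pi.single 0 1

theorem gAct_single (β : kˣ) (j : Fin (m + 1)) :
    gAct γ m β (Pi.single j 1) = ((β : k) * γ ^ (-((j : ℕ) : ℤ))) • Pi.single j 1 := by
  have h := (Pi.basisFun k (Fin (m + 1))).constr_basis k (fun j =>
    ((β : k) * γ ^ (-((j : ℕ) : ℤ))) • (Pi.single j 1 : Fin (m + 1) → k)) j
  rwa [Pi.basisFun_apply] at h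

theorem yAct_single (β : kˣ) (j : Fin (m + 1)) :
    yAct n m β (Pi.single j 1) = if h : (j : ℕ) < m then Pi.single ⟨j + 1, by omega⟩ 1
      else (1 - (β : k) ^ n) • Pi.single 0 1 := by
  have h := (Pi.basisFun k (Fin (m + 1))).constr_basis k (fun j =>
    if h : (j : ℕ) < m then (Pi.single ⟨j + 1, by omega⟩ 1 : Fin (m + 1) → k)
    else (1 - (β : k) ^ n) • Pi.single 0 1) j
  rwa [Pi.basisFun_apply] at h

theorem end_ext {f f' : Module.End k (Fin (m + 1) → k)}
    (h : ∀ j, f (Pi.single j 1) = f' (Pi.single j 1)) : f = f' :=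
  (Pi.basisFun k (Fin (m + 1))).ext fun j => by simpa using h j

theorem gAct_pow (hγ : γ ^ n = 1) (β : kˣ) : gAct γ m β ^ n = ((β : k) ^ n) • 1 := by
  refine end_ext m fun j => ?_
  have : ∀ N : ℕ, (gAct γ m β ^ N) (Pi.single j 1) =
      ((β : k) * γ ^ (-((j : ℕ) : ℤ))) ^ N • Pi.single j 1 := by
    intro N
    induction N with
    | zero => simp
    | succ N ih =>
      rw [pow_succ', Module.End.mul_apply, ih, map_smul, gAct_single, smul_smul, ← pow_succ]
  rw [this, mul_pow, ← zpow_natCast (γ ^ _), ← zpow_mul, mul_comm (-((j : ℕ) : ℤ)), zpow_mul,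
    zpow_natCast, hγ, one_zpow, mul_one]
  rfl

theorem yAct_pow_single (β : kˣ) (N : ℕ) (j : Fin (m + 1)) (h : j + N ≤ m) :
    (yAct n m β ^ N) (Pi.single j 1) = Pi.single ⟨j + N, by omega⟩ 1 := by
  induction N with
  | zero => simp
  | succ N ih =>
    rw [pow_succ', Module.End.mul_apply, ih (by omega), yAct_single, dif_pos (by simp; omega)]
    rfl

theorem yAct_pow_top (β : kˣ) : yAct n m β ^ (m + 1) = (1 - (β : k) ^ n) • 1 := by
  refine end_ext m fun j => ?_
  have e : yAct n m β ^ (m + 1) = yAct n m β ^ ((j : ℕ) + (1 + (m - j))) :=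
    congrArg (fun t => yAct n m β ^ t) (by omega)
  rw [e, pow_add, pow_add, Module.End.mul_apply, Module.End.mul_apply,
    yAct_pow_single n m β (m - j) j (by omega), pow_one, yAct_single, dif_neg (by simp; omega),
    map_smul, yAct_pow_single n m β j 0 (by simp; omega)]
  simp

theorem yAct_mul_gAct (hγ : γ ≠ 0) (β : kˣ) (hm : γ ^ (m + 1) = 1 ∨ (β : k) ^ n = 1) :
    yAct n m β * gAct γ m β = γ • (gAct γ m β * yAct n m β) := by
  refine end_ext m fun j => ?_
  rw [LinearMap.smul_apply, Module.End.mul_apply, Module.End.mul_apply, gAct_single, map_smul,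
    yAct_single]
  split_ifs with h
  · rw [gAct_single, smul_smul]
    congr 1
    rw [mul_left_comm]
    congr 1
    push_cast
    rw [neg_add, zpow_add₀ hγ, zpow_neg_one, mul_comm, mul_assoc, inv_mul_cancel₀ hγ, mul_one]
  · rcases hm with hm | hm
    · rw [map_smul, gAct_single, smul_smul, smul_smul, smul_smul]
      congr 1
      have hj : (j : ℕ) = m := by omega
      have h1 : γ ^ (-((m : ℕ) : ℤ)) = γ := by
        rw [zpow_neg, zpow_natCast]
        refine inv_eq_of_mul_eq_one_right ?_
        rw [← pow_succ, hm]
      rw [hj, h1]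
      simp
      ring
    · simp [hm]

end action

theorem yAct_pow (m : ℕ) (β : kˣ) (hm : m + 1 = n ∨ (m + 1 ≤ n ∧ (β : k) ^ n = 1)) :
    yAct n m β ^ n = 1 - ((β : k) ^ n) • 1 := by
  have h1 : yAct n m β ^ (m + 1) = 1 - ((β : k) ^ n) • 1 := by
    rw [yAct_pow_top]
    exact LinearMap.ext fun v => by simp [sub_smul]
  rcases hm with hm | ⟨hm, hβ⟩
  · have e : yAct n m β ^ n = yAct n m β ^ (m + 1) := congrArg (fun t => yAct n m β ^ t) hm.symm
    rw [e, h1]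
  · have e : yAct n m β ^ n = yAct n m β ^ (m + 1) * yAct n m β ^ (n - (m + 1)) := by
      rw [← pow_add]
      exact congrArg (fun t => yAct n m β ^ t) (by omega)
    rw [e, h1, hβ, one_smul, sub_self, zero_mul]

theorem liuTop_cases [NeZero n] [hγ : Fact (IsPrimitiveRoot γ n)] (β : kˣ) (i : ℤ) :
    liuTop n γ β i + 1 = n ∨ (liuTop n γ β i + 1 ≤ n ∧ (β : k) ^ n = 1) := by
  have hn := NeZero.pos n
  unfold liuTop
  split_ifs with h
  · right
    refine ⟨?_, ?_⟩
    · have := ((liuPhi_unique n (-i - h.choose) _).mp rfl).1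
      omega
    · rw [h.choose_spec, ← zpow_natCast, ← zpow_mul, mul_comm, zpow_mul, zpow_natCast,
        hγ.out.pow_eq_one, one_zpow]
  · left; omega

/-- The data of action and coaction of the module `V(α, β, x^r g^i)` with basis `v₀, …, v_m`:
`x · v_j = α v_j`, `g · v_j = β γ^{-j} v_j`, `y · v_j = v_{j+1}` for `j < m`,
`y · v_m = (1 - βⁿ) v₀` and `δ(v_j) = ∑_{l ≤ j} c_β^{r,i}(j, l) ⊗ v_l`. -/
noncomputable def V [NeZero n] [hγ : Fact (IsPrimitiveRoot γ n)] (α β : kˣ) (r i : ℤ)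
    (hαβ : α ^ w = β ^ n) :
    ActionCoaction k (LiuAlgebra n w γ) (Fin (liuTop n γ β i + 1) → k) where
  act := lift ((α : k) • 1) (((α⁻¹ : kˣ) : k) • 1) (gAct γ (liuTop n γ β i) β)
    (yAct n (liuTop n γ β i) β)
    (by simp [smul_smul])
    (by simp [smul_smul])
    (by simp)
    (by simp)
    (by
      refine yAct_mul_gAct n γ _ (hγ.out.ne_zero (NeZero.ne n)) β ?_
      rcases liuTop_cases n γ β i with h | h
      · left; rw [h, hγ.out.pow_eq_one]
      · right; exact h.2)
    (by
      have hαβ' : (α : k) ^ w = (β : k) ^ n := by exact_mod_cast congrArg Units.val hαβ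
      rw [smul_pow, one_pow, hαβ']
      exact yAct_pow n _ β (liuTop_cases n γ β i))
    (by
      have hαβ' : (α : k) ^ w = (β : k) ^ n := by exact_mod_cast congrArg Units.val hαβ
      rw [smul_pow, one_pow, hαβ', gAct_pow n γ _ hγ.out.pow_eq_one])
  coact := (Pi.basisFun k (Fin (liuTop n γ β i + 1))).constr k fun j =>
    ∑ l ∈ Finset.univ.filter (fun l => l ≤ j),
      coactionCoeff n w γ β r i (j : ℕ) (l : ℕ) ⊗ₜ[k] (Pi.single l 1 : Fin _ → k)

section V

variable [NeZero n] [hγ : Fact (IsPrimitiveRoot γ n)] (α β : kˣ) (r i : ℤ) (hαβ : α ^ w = β ^ n)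

theorem V_act_x : (V n w γ α β r i hαβ).act (x n w γ) = (α : k) • 1 := by
  simp only [V]
  exact lift_x (n := n) (w := w) (γ := γ) _ _ _ _ _ _ _ _ _ _ _

theorem V_act_g (j : Fin (liuTop n γ β i + 1)) :
    (V n w γ α β r i hαβ).act (g n w γ) (Pi.single j 1) =
      ((β : k) * γ ^ (-((j : ℕ) : ℤ))) • Pi.single j 1 := by
  have h : (V n w γ α β r i hαβ).act (g n w γ) = gAct γ (liuTop n γ β i) β := by
    simp only [V]
    exact lift_g (n := n) (w := w) (γ := γ) _ _ _ _ _ _ _ _ _ _ _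
  rw [h, gAct_single]

theorem V_act_y (j : Fin (liuTop n γ β i + 1)) :
    (V n w γ α β r i hαβ).act (y n w γ) (Pi.single j 1) =
      if h : (j : ℕ) < liuTop n γ β i then Pi.single ⟨j + 1, by omega⟩ 1
      else (1 - (β : k) ^ n) • Pi.single 0 1 := by
  have h : (V n w γ α β r i hαβ).act (y n w γ) = yAct n (liuTop n γ β i) β := by
    simp only [V]
    exact lift_y (n := n) (w := w) (γ := γ) _ _ _ _ _ _ _ _ _ _ _
  rw [h, yAct_single]

theorem V_coact (j : Fin (liuTop n γ β i + 1)) :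
    (V n w γ α β r i hαβ).coact (Pi.single j 1) =
      ∑ l ∈ Finset.univ.filter (fun l => l ≤ j),
        coactionCoeff n w γ β r i (j : ℕ) (l : ℕ) ⊗ₜ[k] (Pi.single l 1 : Fin _ → k) := by
  have h := (Pi.basisFun k (Fin (liuTop n γ β i + 1))).constr_basis k (fun j =>
    ∑ l ∈ Finset.univ.filter (fun l => l ≤ j),
      coactionCoeff n w γ β r i (j : ℕ) (l : ℕ) ⊗ₜ[k] (Pi.single l 1 : Fin _ → k)) j
  rwa [Pi.basisFun_apply] at h

end V

end LiuAlgebra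

end LiuAlgebra

/-!
The algebra `B(n, w, γ)` has the basis `y^a x^r g^i` with `a < n`: for `h` in the span of the
monomials `x^r g^i`, the elements `y^a h` with different `a` are eigenvectors of conjugation by `g`
with different eigenvalues, and `y^n = 1 - x^w` is not a zero divisor on that span because `x` has
infinite order.

The coefficients of the coaction are `c(d + l, l) = s(d, l) y^d x^r g^(i-d-l)` with scalars
`s(d, l)`, where `s(d, 0)` is the product of the `β - γ^(e-i)` with `0 ≤ e < d`. It is nonzero for
`d ≤ m`, so every nonzero subobject of `V(α, β, x^r g^i)` contains `v_0`. Hence `V` is simple, and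
`v_0` is up to scalars its only vector `v` with `δ(v) = h ⊗ v`.

Conversely, let `M` be simple. A vector coefficient of maximal `y`-degree in a coaction yields a `v`
with `δ(v) = x^r g^i ⊗ v`, and `M = H v` is finitely generated over `k[x, x⁻¹]`. By Zariski's lemma
some `x - α` is not surjective on `M`; being an endomorphism of `M`, it vanishes. Then `g^n` acts
by `α^w`, and `v` can be chosen to be an eigenvector of `g` with eigenvalue `β`. Now
`y^(m+1) v = (1 - β^n) v`: otherwise `β^n = 1`, and `u = y^(m+1) v` satisfies `δ(u) = h ⊗ u` for a
monomial `h`, so `M = H u`, which makes `y` surjective although `y^n = 0` on `M`. So `v_0 ↦ v`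
extends to a nonzero morphism from `V(α, β, x^r g^i)` to `M`.
-/

/-! ## The Poincaré–Birkhoff–Witt basis -/

theorem mul_units_zpow_of_qcomm {k R : Type*} [Field k] [Ring R] [Algebra k R] {q : k}
    (hq : q ≠ 0) (a : R) (u : Rˣ) (h : a * u = q • (u * a)) (i : ℤ) :
    a * (u ^ i : Rˣ) = q ^ i • ((u ^ i : Rˣ) * a) := by
  let c : Rˣ := Units.map (algebraMap k R : k →* R) (Units.mk0 q hq)
  have hc : Commute c u := Units.ext (Algebra.commutes q (u : R))
  have hzpow : ((c ^ i : Rˣ) : R) = algebraMap k R (q ^ i) := by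
    rw [← map_zpow, Units.coe_map, Units.val_zpow_eq_zpow_val, Units.val_mk0]
    rfl
  have hsemi : SemiconjBy a (u : R) ((c * u : Rˣ) : R) := by
    rw [SemiconjBy, h, Algebra.smul_def, ← mul_assoc]
    rfl
  rw [(hsemi.units_zpow_right i).eq, hc.mul_zpow, Units.val_mul, hzpow, Algebra.smul_def,
    mul_assoc]

namespace LiuAlgebra

variable {k : Type*} [Field k] {n w : ℕ} {γ : k} [NeZero n]

section Monomials

theorem xg_mul (r i r' i' : ℤ) :
    xg n w γ r i * xg n w γ r' i' = xg n w γ (r + r') (i + i') := by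
  have hcomm : Commute (xUnit n w γ) (gUnit n w γ) := Units.ext (x_mul_g n w γ)
  simp only [xg, ← Units.val_mul, zpow_add]
  rw [(hcomm.zpow_zpow r' i).symm.mul_mul_mul_comm]

theorem xg_zero : xg n w γ 0 0 = 1 := by simp [xg]

theorem x_eq_xg : x n w γ = xg n w γ 1 0 := by simp [xg, xUnit]

theorem xinv_eq_xg : xinv n w γ = xg n w γ (-1) 0 := by simp [xg, xUnit]

theorem g_eq_xg : g n w γ = xg n w γ 0 1 := by simp [xg, gUnit]

theorem ginv_eq_xg : ginv n w γ = xg n w γ 0 (-1) := by simp [xg, ginv]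

theorem x_pow_eq_xg (N : ℕ) : x n w γ ^ N = xg n w γ N 0 := by simp [xg, xUnit]

theorem g_pow_eq_xg (N : ℕ) : g n w γ ^ N = xg n w γ 0 N := by simp [xg, gUnit]

theorem isUnit_xg (r i : ℤ) : IsUnit (xg n w γ r i) := Units.isUnit _

theorem y_mul_xg (hγ : γ ≠ 0) (r i : ℤ) :
    y n w γ * xg n w γ r i = γ ^ i • (xg n w γ r i * y n w γ) := by
  have hx := ((show Commute (x n w γ) (y n w γ) from x_mul_y n w γ).units_zpow_left
    (u := xUnit n w γ) r).eq
  have hg := mul_units_zpow_of_qcomm hγ (y n w γ) (gUnit n w γ) (y_mul_g n w γ) i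
  rw [xg, Units.val_mul, ← mul_assoc, ← hx, mul_assoc, hg, mul_smul_comm, mul_assoc]

theorem xg_mul_y (hγ : γ ≠ 0) (r i : ℤ) :
    xg n w γ r i * y n w γ = γ ^ (-i) • (y n w γ * xg n w γ r i) := by
  rw [y_mul_xg hγ, smul_smul, ← zpow_add₀ hγ, neg_add_cancel, zpow_zero, one_smul]

theorem xg_mul_y_pow (hγ : γ ≠ 0) (r i : ℤ) (a : ℕ) :
    xg n w γ r i * y n w γ ^ a = γ ^ (-i * a) • (y n w γ ^ a * xg n w γ r i) := by
  rw [qcomm_mul_pow (γ ^ (-i)) _ _ (xg_mul_y hγ r i), zpow_mul, zpow_natCast]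

theorem exists_mul_y_eq_y_mul (hγ : γ ≠ 0) (h : LiuAlgebra n w γ) :
    ∃ h', h * y n w γ = y n w γ * h' := by
  have of_xg (r i : ℤ) : ∃ h', xg n w γ r i * y n w γ = y n w γ * h' :=
    ⟨γ ^ (-i) • xg n w γ r i, by rw [xg_mul_y hγ, mul_smul_comm]⟩
  induction h using induction with
  | hc c => exact ⟨algebraMap k _ c, Algebra.commutes c _⟩
  | hx => rw [x_eq_xg]; exact of_xg _ _
  | hx' => rw [xinv_eq_xg]; exact of_xg _ _
  | hg => rw [g_eq_xg]; exact of_xg _ _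
  | hy => exact ⟨y n w γ, rfl⟩
  | hadd a b ha hb =>
    obtain ⟨a', ha⟩ := ha
    obtain ⟨b', hb⟩ := hb
    exact ⟨a' + b', by rw [add_mul, mul_add, ha, hb]⟩
  | hmul a b ha hb =>
    obtain ⟨a', ha⟩ := ha
    obtain ⟨b', hb⟩ := hb
    exact ⟨a' * b', by rw [mul_assoc, hb, ← mul_assoc, ha, mul_assoc]⟩

variable (n w γ) in
/-- The set of the monomials `x^r g^i`. It serves as an index set because the monomials of the
different pairs `(r, i)` may coincide: `x^w = g^n`. -/
def xgSet : Set (LiuAlgebra n w γ) := {h | ∃ r i : ℤ, h = xg n w γ r i}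

variable (n w γ) in
/-- The Poincaré–Birkhoff–Witt monomials `y^a x^r g^i` with `a < n`. -/
noncomputable def pbwMonomial (p : Fin n × xgSet n w γ) : LiuAlgebra n w γ :=
  y n w γ ^ (p.1 : ℕ) * p.2

theorem top_le_span_pbwMonomial (hγ : γ ≠ 0) :
    ⊤ ≤ Submodule.span k (Set.range (pbwMonomial n w γ)) := by
  set S := Submodule.span k (Set.range (pbwMonomial n w γ))
  have mem {a : ℕ} (ha : a < n) (r i : ℤ) : y n w γ ^ a * xg n w γ r i ∈ S :=
    Submodule.subset_span ⟨(⟨a, ha⟩, ⟨_, r, i, rfl⟩), rfl⟩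
  have mem_zero (r i : ℤ) : xg n w γ r i ∈ S := by simpa using mem (NeZero.pos n) r i
  have mul_xg (r i : ℤ) : S ≤ S.comap (LinearMap.mulRight k (xg n w γ r i)) := by
    refine Submodule.span_le.mpr ?_
    rintro _ ⟨⟨a, _, r', i', rfl⟩, rfl⟩
    simpa only [pbwMonomial, SetLike.mem_coe, Submodule.mem_comap, LinearMap.mulRight_apply,
      mul_assoc, xg_mul] using mem a.2 _ _
  have mul_y : S ≤ S.comap (LinearMap.mulRight k (y n w γ)) := by
    refine Submodule.span_le.mpr ?_
    rintro _ ⟨⟨a, _, r, i, rfl⟩, rfl⟩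
    simp only [pbwMonomial, SetLike.mem_coe, Submodule.mem_comap, LinearMap.mulRight_apply,
      mul_assoc, xg_mul_y hγ, mul_smul_comm]
    rw [← mul_assoc, ← pow_succ]
    refine S.smul_mem _ ?_
    rcases (Nat.succ_le_of_lt a.2).lt_or_eq with ha | ha
    · exact mem ha r i
    · rw [Nat.succ_eq_add_one] at ha
      rw [ha, y_pow, x_pow_eq_xg, sub_mul, one_mul, xg_mul]
      exact S.sub_mem (mem_zero _ _) (mem_zero _ _)
  have mul_right (h : LiuAlgebra n w γ) : ∀ s ∈ S, s * h ∈ S := by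
    induction h using induction with
    | hc c => intro s hs; rw [← Algebra.commutes, ← Algebra.smul_def]; exact S.smul_mem _ hs
    | hx => rw [x_eq_xg]; exact mul_xg _ _
    | hx' => rw [xinv_eq_xg]; exact mul_xg _ _
    | hg => rw [g_eq_xg]; exact mul_xg _ _
    | hy => exact mul_y
    | hadd a b ha hb => intro s hs; rw [mul_add]; exact S.add_mem (ha s hs) (hb s hs)
    | hmul a b ha hb => intro s hs; rw [← mul_assoc]; exact hb _ (ha s hs)
  intro h _
  simpa [xg_zero] using mul_right h 1 (by simpa [xg_zero] using mem_zero 0 0)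

end Monomials

theorem gamma_ne_zero (n : ℕ) (γ : k) [NeZero n] [hγ : Fact (IsPrimitiveRoot γ n)] : γ ≠ 0 :=
  hγ.out.ne_zero (NeZero.ne n)

section Hopf

variable [hγ : Fact (IsPrimitiveRoot γ n)]

theorem isGroupLikeElem_xg (r i : ℤ) : IsGroupLikeElem k (xg n w γ r i) := by
  have hx : IsGroupLikeElem k (x n w γ) := ⟨counitHom_x n w γ, comulHom_x n w γ⟩
  have hg : IsGroupLikeElem k (g n w γ) := ⟨counitHom_g n w γ, comulHom_g n w γ⟩
  have hzpow (u : (LiuAlgebra n w γ)ˣ) (hu : IsGroupLikeElem k (u : LiuAlgebra n w γ)) (r : ℤ) :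
      IsGroupLikeElem k ((u ^ r : (LiuAlgebra n w γ)ˣ) : LiuAlgebra n w γ) := by
    have hinv : IsGroupLikeElem k ((u⁻¹ : (LiuAlgebra n w γ)ˣ) : LiuAlgebra n w γ) :=
      hu.of_mul_eq_one u.mul_inv u.inv_mul
    cases r with
    | ofNat r => simpa using hu.pow (n := r)
    | negSucc r => rw [zpow_negSucc, ← inv_pow]; exact hinv.pow (n := r + 1)
  rw [xg, Units.val_mul]
  exact (hzpow (xUnit n w γ) hx r).mul (hzpow (gUnit n w γ) hg i)

theorem comul_y :
    Coalgebra.comul (R := k) (y n w γ) = y n w γ ⊗ₜ g n w γ + 1 ⊗ₜ y n w γ :=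
  comulHom_y n w γ

theorem antipode_g : HopfAlgebra.antipode k (g n w γ) = ginv n w γ := by
  change antipodeLin n w γ _ = _
  rw [antipodeLin_apply, antipodeHom_g, MulOpposite.unop_op]

theorem antipode_y : HopfAlgebra.antipode k (y n w γ) = -(y n w γ * ginv n w γ) := by
  change antipodeLin n w γ _ = _
  rw [antipodeLin_apply, antipodeHom_y, MulOpposite.unop_op]

theorem comul_y_pow_mul_xg (a : ℕ) (r i : ℤ) :
    Coalgebra.comul (R := k) (y n w γ ^ a * xg n w γ r i) =
      ∑ p ∈ Finset.HasAntidiagonal.antidiagonal a, qBinomAux γ p.1 p.2 •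
        ((y n w γ ^ p.1 * xg n w γ r i) ⊗ₜ[k]
          (g n w γ ^ p.1 * y n w γ ^ p.2 * xg n w γ r i)) := by
  rw [Bialgebra.comul_mul, Bialgebra.comul_pow, (isGroupLikeElem_xg r i).comul_eq_tmul_self,
    comul_y, qBinom_add_pow γ _ _ (by simp [y_mul_g]), Finset.sum_mul]
  refine Finset.sum_congr rfl fun p _ => ?_
  simp [Algebra.TensorProduct.tmul_pow]

end Hopf

section InfiniteOrder

variable [hγ : Fact (IsPrimitiveRoot γ n)]

variable (w) in
/-- Over the field `k(T)`, `x` can act by `T^n` and `g` by the operator `v_j ↦ T^w γ^{-j} v_j`. -/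
theorem exists_algHom_apply_x_eq_X_pow :
    ∃ f : LiuAlgebra n w γ →ₐ[k] Module.End (RatFunc k) (Fin (n - 1 + 1) → RatFunc k),
      f (x n w γ) = ((RatFunc.X : RatFunc k) ^ n) • 1 := by
  let γ' := algebraMap k (RatFunc k) γ
  have hγ' : IsPrimitiveRoot γ' n := hγ.out.map_of_injective (algebraMap k (RatFunc k)).injective
  have hn : n - 1 + 1 = n := Nat.sub_add_cancel NeZero.one_le
  let T : (RatFunc k)ˣ := Units.mk0 RatFunc.X RatFunc.X_ne_zero
  have hpow : ((RatFunc.X : RatFunc k) ^ n) ^ w = ((T ^ w : (RatFunc k)ˣ) : RatFunc k) ^ n := by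
    rw [Units.val_pow_eq_pow_val, Units.val_mk0, ← pow_mul, ← pow_mul, mul_comm]
  refine ⟨lift ((RatFunc.X : RatFunc k) ^ n • 1) ((RatFunc.X : RatFunc k)⁻¹ ^ n • 1)
    (gAct γ' (n - 1) (T ^ w)) (yAct n (n - 1) (T ^ w)) ?_ ?_ (by simp) (by simp) ?_ ?_ ?_,
    lift_x (n := n) (w := w) (γ := γ) _ _ _ _ _ _ _ _ _ _ _⟩
  · simp [smul_smul, RatFunc.X_ne_zero]
  · simp [smul_smul, RatFunc.X_ne_zero]
  · rw [yAct_mul_gAct n γ' _ (hγ'.ne_zero (NeZero.ne n)) _ (Or.inl (by rw [hn, hγ'.pow_eq_one])),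
      algebraMap_smul]
  · rw [smul_pow, one_pow, hpow]
    exact yAct_pow n _ _ (Or.inl hn)
  · rw [smul_pow, one_pow, hpow, gAct_pow n γ' _ hγ'.pow_eq_one]

theorem x_pow_ne_one {N : ℕ} (hN : N ≠ 0) : x n w γ ^ N ≠ 1 := by
  intro h
  obtain ⟨f, hf⟩ := exists_algHom_apply_x_eq_X_pow (n := n) (γ := γ) w
  have hX : ((RatFunc.X : RatFunc k) ^ (n * N)) = 1 := by
    have hend : ((RatFunc.X : RatFunc k) ^ (n * N)) •
        (1 : Module.End (RatFunc k) (Fin (n - 1 + 1) → RatFunc k)) = 1 := by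
      have := congrArg f h
      rwa [map_pow, hf, smul_pow, one_pow, map_one, ← pow_mul] at this
    simpa using congrFun (LinearMap.congr_fun hend 1) 0
  rw [← RatFunc.algebraMap_X, ← map_pow, ← map_one (algebraMap (Polynomial k) (RatFunc k))] at hX
  have hdeg := congrArg Polynomial.natDegree (RatFunc.algebraMap_injective k hX)
  rw [Polynomial.natDegree_X_pow, Polynomial.natDegree_one] at hdeg
  exact (mul_ne_zero (NeZero.ne n) hN) hdeg

variable [NeZero w]

theorem y_ne_zero : y n w γ ≠ 0 := by
  intro hy
  have h := y_pow n w γ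
  rw [hy, zero_pow (NeZero.ne n), eq_comm, sub_eq_zero] at h
  exact x_pow_ne_one (NeZero.ne w) h.symm

theorem zpow_eq_zpow_of_xg_eq {r i r' i' : ℤ} (h : xg n w γ r i = xg n w γ r' i') :
    γ ^ i = γ ^ i' := by
  have hne : xg n w γ r i * y n w γ ≠ 0 := fun h0 =>
    y_ne_zero ((isUnit_xg r i).mul_right_eq_zero.mp h0)
  refine smul_left_injective k hne ?_
  change γ ^ i • (xg n w γ r i * y n w γ) = γ ^ i' • (xg n w γ r i * y n w γ)
  rw [← y_mul_xg (gamma_ne_zero n γ), h, ← y_mul_xg (gamma_ne_zero n γ)]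

end InfiniteOrder

end LiuAlgebra

theorem finsupp_eq_zero_of_apply_comp_eq {ι M : Type*} [Zero M] {σ : ι → ι}
    (hσ : ∀ p, Function.Injective fun N : ℕ => σ^[N] p) {c : ι →₀ M}
    (hc : ∀ p, c (σ p) = c p) : c = 0 := by
  by_contra hne
  obtain ⟨p, hp⟩ := Finsupp.ne_iff.mp hne
  have hiter (N : ℕ) : c (σ^[N] p) = c p := by
    induction N with
    | zero => rfl
    | succ N ih => rw [Function.iterate_succ_apply', hc, ih]
  refine Set.infinite_of_injective_forall_mem (hσ p) (s := (c.support : Set ι)) (fun N => ?_)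
    c.support.finite_toSet
  simpa [hiter N] using hp

namespace LiuAlgebra

variable {k : Type*} [Field k] {n w : ℕ} {γ : k} [NeZero n]

section PBW

variable (n w γ) in
/-- Multiplication by `x^w` on the set of the monomials `x^r g^i`. -/
noncomputable def xPowMul (h : xgSet n w γ) : xgSet n w γ :=
  ⟨x n w γ ^ w * h, by
    obtain ⟨_, r, i, rfl⟩ := h
    exact ⟨w + r, 0 + i, by rw [x_pow_eq_xg, xg_mul]⟩⟩

variable [hγ : Fact (IsPrimitiveRoot γ n)]

theorem linearIndependent_xgSet :
    LinearIndependent k (Subtype.val : xgSet n w γ → LiuAlgebra n w γ) := by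
  have h : LinearIndepOn k id (xgSet n w γ) := by
    refine linearIndepOn_isGroupLikeElem.mono ?_
    rintro _ ⟨r, i, rfl⟩
    exact isGroupLikeElem_xg r i
  exact h

theorem y_pow_mul_mem_eigenspace_conj_g (a : ℕ) {s : LiuAlgebra n w γ}
    (hs : s ∈ Submodule.span k (xgSet n w γ)) :
    y n w γ ^ a * s ∈ Module.End.eigenspace
      (LinearMap.mulLeft k (g n w γ) ∘ₗ LinearMap.mulRight k (ginv n w γ)) ((γ ^ a)⁻¹) := by
  suffices h : Submodule.span k (xgSet n w γ) ≤ (Module.End.eigenspace _ ((γ ^ a)⁻¹)).comap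
      (LinearMap.mulLeft k (y n w γ ^ a)) from h hs
  refine Submodule.span_le.mpr ?_
  rintro _ ⟨r, i, rfl⟩
  rw [SetLike.mem_coe, Submodule.mem_comap, Module.End.mem_eigenspace_iff]
  simp only [LinearMap.comp_apply, LinearMap.mulLeft_apply, LinearMap.mulRight_apply]
  rw [mul_assoc, ← mul_assoc (g n w γ), g_eq_xg, xg_mul_y_pow (gamma_ne_zero n γ), ginv_eq_xg,
    smul_mul_assoc, mul_assoc, xg_mul, xg_mul]
  simp

variable [NeZero w]

theorem xPowMul_iterate_injective (h : xgSet n w γ) :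
    Function.Injective fun N : ℕ => (xPowMul n w γ)^[N] h := by
  have hval (N : ℕ) : (((xPowMul n w γ)^[N] h : xgSet n w γ) : LiuAlgebra n w γ) =
      (x n w γ ^ w) ^ N * h := by
    rw [← mul_left_iterate_apply]
    exact ((show Function.Semiconj (Subtype.val : xgSet n w γ → LiuAlgebra n w γ)
      (xPowMul n w γ) (x n w γ ^ w * ·) from fun _ => rfl).iterate_right N).eq h
  have hpow : Function.Injective fun N : ℕ => (xUnit n w γ ^ w) ^ N := by
    rw [injective_pow_iff_not_isOfFinOrder, isOfFinOrder_iff_pow_eq_one]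
    rintro ⟨N, hN, h1⟩
    refine x_pow_ne_one (n := n) (w := w) (γ := γ) (mul_ne_zero (NeZero.ne w) hN.ne') ?_
    rw [pow_mul]
    exact congrArg Units.val h1
  intro N N' hN
  obtain ⟨_, r, i, rfl⟩ := h
  have hmul := congrArg Subtype.val hN
  simp only [hval] at hmul
  exact hpow (Units.ext ((isUnit_xg r i).mul_right_cancel hmul))

theorem eq_zero_of_x_pow_mul_eq {s : LiuAlgebra n w γ}
    (hs : s ∈ Submodule.span k (xgSet n w γ)) (h : x n w γ ^ w * s = s) : s = 0 := by
  rw [← Subtype.range_val (s := xgSet n w γ), Finsupp.mem_span_range_iff_exists_finsupp] at hs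
  obtain ⟨c, rfl⟩ := hs
  have hmap : c.mapDomain (xPowMul n w γ) = c := by
    refine linearIndependent_xgSet ?_
    rw [Finsupp.linearCombination_mapDomain, Finsupp.linearCombination_apply,
      Finsupp.linearCombination_apply, ← h, Finsupp.sum, Finsupp.sum, Finset.mul_sum]
    exact Finset.sum_congr rfl fun p _ => (mul_smul_comm _ _ _).symm
  have hinj : Function.Injective (xPowMul n w γ) := fun p q hpq => by
    refine Subtype.ext (((xUnit n w γ ^ w).isUnit).mul_left_cancel ?_)
    exact congrArg Subtype.val hpq
  have hc : c = 0 := finsupp_eq_zero_of_apply_comp_eq xPowMul_iterate_injective fun p => by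
    conv_lhs => rw [← hmap]
    exact Finsupp.mapDomain_apply hinj c p
  rw [hc, Finsupp.sum_zero_index]

theorem eq_zero_of_sum_y_pow_mul_eq_zero {u : Fin n → LiuAlgebra n w γ}
    (hu : ∀ a, u a ∈ Submodule.span k (xgSet n w γ))
    (h : ∑ a : Fin n, y n w γ ^ (a : ℕ) * u a = 0) (a : Fin n) : u a = 0 := by
  have hinj : Function.Injective fun a : Fin n => (γ ^ (a : ℕ))⁻¹ := fun a b hab =>
    Fin.ext (hγ.out.pow_inj a.2 b.2 (inv_injective hab))
  have hindep := (Module.End.eigenspaces_iSupIndep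
    (LinearMap.mulLeft k (g n w γ) ∘ₗ LinearMap.mulRight k (ginv n w γ))).comp hinj
  have hterm : y n w γ ^ (a : ℕ) * u a = 0 :=
    (iSupIndep_iff_finsetSum_eq_zero_imp_eq_zero _).mp hindep Finset.univ _
      (fun a _ => y_pow_mul_mem_eigenspace_conj_g a (hu a)) h a (Finset.mem_univ a)
  refine eq_zero_of_x_pow_mul_eq (hu a) ?_
  have hpow : y n w γ ^ n * u a = 0 := by
    have hsplit : y n w γ ^ n = y n w γ ^ (n - a) * y n w γ ^ (a : ℕ) := by
      rw [← pow_add, Nat.sub_add_cancel a.2.le]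
    rw [hsplit, mul_assoc, hterm, mul_zero]
  rw [y_pow, sub_mul, one_mul, sub_eq_zero] at hpow
  exact hpow.symm

theorem linearIndependent_pbwMonomial : LinearIndependent k (pbwMonomial n w γ) := by
  rw [linearIndependent_iff]
  intro l hl
  let u (a : Fin n) : LiuAlgebra n w γ := Finsupp.linearCombination k Subtype.val (l.curry a)
  have hu (a : Fin n) : u a ∈ Submodule.span k (xgSet n w γ) := by
    rw [← Subtype.range_val (s := xgSet n w γ)]
    exact Finsupp.mem_span_range_iff_exists_finsupp.mpr ⟨l.curry a, rfl⟩
  have hsum : ∑ a : Fin n, y n w γ ^ (a : ℕ) * u a = 0 := by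
    rw [← hl, Finsupp.linearCombination_apply,
      ← Finsupp.sum_curry_index l (fun a h c => c • pbwMonomial n w γ (a, h)),
      Finsupp.sum_fintype _ _ (by simp)]
    refine Finset.sum_congr rfl fun a _ => ?_
    simp only [u, Finsupp.linearCombination_apply, Finsupp.sum, Finset.mul_sum, mul_smul_comm]
    rfl
  ext ⟨a, h⟩
  have hcurry : l.curry a = 0 :=
    linearIndependent_iff.mp linearIndependent_xgSet _ (eq_zero_of_sum_y_pow_mul_eq_zero hu hsum a)
  simpa [Finsupp.curry_apply] using DFunLike.congr_fun hcurry h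

variable (n w γ) in
/-- The Poincaré–Birkhoff–Witt basis `y^a x^r g^i`, `a < n`, of `B(n, w, γ)`. -/
noncomputable def pbwBasis : Module.Basis (Fin n × xgSet n w γ) k (LiuAlgebra n w γ) :=
  .mk linearIndependent_pbwMonomial (top_le_span_pbwMonomial (gamma_ne_zero n γ))

theorem pbwBasis_apply (p : Fin n × xgSet n w γ) :
    pbwBasis n w γ p = y n w γ ^ (p.1 : ℕ) * p.2 := by
  rw [pbwBasis, Module.Basis.mk_apply, pbwMonomial]

open Classical in
theorem coord_y_pow_mul (p : Fin n × xgSet n w γ) {b : ℕ} (hb : b < n) (h : xgSet n w γ) :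
    (pbwBasis n w γ).coord p (y n w γ ^ b * h) = if b = p.1 ∧ h = p.2 then 1 else 0 := by
  rw [show y n w γ ^ b * h = pbwBasis n w γ (⟨b, hb⟩, h) from (pbwBasis_apply (⟨b, hb⟩, h)).symm,
    Module.Basis.coord_apply, Module.Basis.repr_self, Finsupp.single_apply]
  simp only [Prod.ext_iff, Fin.ext_iff]

open Classical in
theorem coord_rTensor_comul {a b : Fin n} (hba : b ≤ a) (h h' : xgSet n w γ) :
    TensorProduct.lid k _ (((pbwBasis n w γ).coord (a, h)).rTensor _
      (Coalgebra.comul (R := k) (pbwBasis n w γ (b, h')))) =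
    if (b, h') = (a, h) then g n w γ ^ (a : ℕ) * (h : LiuAlgebra n w γ) else 0 := by
  rw [Fin.le_def] at hba
  obtain ⟨_, r, i, rfl⟩ := h'
  have hcoord (p : ℕ × ℕ) (hp : p ∈ Finset.HasAntidiagonal.antidiagonal (b : ℕ)) :
      (pbwBasis n w γ).coord (a, h) (y n w γ ^ p.1 * xg n w γ r i) =
        if p = ((a : ℕ), 0) ∧ ⟨_, r, i, rfl⟩ = h then 1 else 0 := by
    rw [Finset.HasAntidiagonal.mem_antidiagonal] at hp
    refine (coord_y_pow_mul (a, h) (by omega : p.1 < n) ⟨_, r, i, rfl⟩).trans (if_congr ?_ rfl rfl)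
    simp only [Prod.ext_iff]
    exact and_congr_left fun _ => ⟨fun h => ⟨h, by omega⟩, fun h => h.1⟩
  rw [pbwBasis_apply, comul_y_pow_mul_xg]
  simp only [map_sum, map_smul, LinearMap.rTensor_tmul, TensorProduct.lid_tmul]
  rw [Finset.sum_congr rfl fun p hp => by rw [hcoord p hp]]
  by_cases heq : (b, (⟨_, r, i, rfl⟩ : xgSet n w γ)) = (a, h)
  · obtain ⟨rfl, rfl⟩ := Prod.ext_iff.mp heq
    rw [if_pos heq, Finset.sum_eq_single ((b : ℕ), 0)]
    · simp [qBinomAux_zero_right]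
    · intro p _ hp
      simp [hp]
    · simp
  · rw [if_neg heq]
    refine Finset.sum_eq_zero fun p hp => ?_
    rw [if_neg, zero_smul, smul_zero]
    rintro ⟨rfl, rfl⟩
    rw [Finset.HasAntidiagonal.mem_antidiagonal] at hp
    exact heq (Prod.ext (Fin.ext (by simpa using hp.symm)) rfl)

end PBW

end LiuAlgebra

/-! ## The coefficients of the coaction -/

theorem qBinomAux_succ_succ_left {k : Type*} [Field k] (q : k) (i j : ℕ) :
    qBinomAux q (i + 1) (j + 1) = q ^ (j + 1) * qBinomAux q i (j + 1) + qBinomAux q (i + 1) j := by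
  rw [qBinomAux_succ_succ]
  linear_combination qBinomAux_identity q i j

section PrimitiveRoot

variable {k : Type*} [Field k] {n : ℕ} [NeZero n] {γ : k}

theorem prod_range_sub_zpow (hγ : IsPrimitiveRoot γ n) (b : k) (i : ℤ) :
    ∏ s ∈ Finset.range n, (b - γ ^ (s - i)) = b ^ n - 1 := by
  have hone : (γ ^ (-i)) ^ n = 1 := by
    rw [← zpow_natCast, zpow_comm, zpow_natCast, hγ.pow_eq_one, one_zpow]
  have h := congrArg (Polynomial.eval b) (X_pow_sub_C_eq_prod hγ (NeZero.pos n) hone)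
  simp only [Polynomial.eval_sub, Polynomial.eval_pow, Polynomial.eval_X, Polynomial.eval_C,
    Polynomial.eval_prod] at h
  rw [h]
  refine Finset.prod_congr rfl fun s _ => ?_
  rw [sub_eq_add_neg (s : ℤ), zpow_add₀ (hγ.ne_zero (NeZero.ne n)), zpow_natCast]

theorem eq_of_zpow_natCast_sub_eq (hγ : IsPrimitiveRoot γ n) {s t : ℕ} (hs : s < n) (ht : t < n)
    {i : ℤ} (h : γ ^ (s - i) = γ ^ (t - i)) : s = t := by
  have hγ0 : γ ≠ 0 := hγ.ne_zero (NeZero.ne n)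
  rw [zpow_sub₀ hγ0, zpow_sub₀ hγ0, div_left_inj' (zpow_ne_zero i hγ0), zpow_natCast,
    zpow_natCast] at h
  exact hγ.pow_inj hs ht h

variable [hγ : Fact (IsPrimitiveRoot γ n)]

theorem liuTop_lt (β : kˣ) (i : ℤ) : liuTop n γ β i < n := by
  rcases LiuAlgebra.liuTop_cases n γ β i with h | ⟨h, -⟩ <;> omega

theorem liuTop_eq_of_pow_ne_one {β : kˣ} (i : ℤ) (h : (β : k) ^ n ≠ 1) :
    liuTop n γ β i + 1 = n :=
  (LiuAlgebra.liuTop_cases n γ β i).resolve_right fun h' => h h'.2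

theorem liuTop_eq_of_eq_zpow {β : kˣ} (i : ℤ) {j : ℤ} (h : (β : k) = γ ^ j) :
    liuTop n γ β i = n - liuPhi n (-i - j) := by
  have hex : ∃ j : ℤ, (β : k) = γ ^ j := ⟨j, h⟩
  have hdvd : (n : ℤ) ∣ -i - hex.choose - (-i - j) := by
    rw [sub_sub_sub_cancel_left, dvd_sub_comm, ← hγ.out.zpow_eq_one_iff_dvd,
      zpow_sub₀ (hγ.out.ne_zero (NeZero.ne n)), ← hex.choose_spec, ← h, div_self β.ne_zero]
  obtain ⟨hpos, hle, hmod⟩ := (liuPhi_unique n (-i - hex.choose) _).mp rfl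
  rw [liuTop, dif_pos hex,
    (liuPhi_unique n (-i - j) _).mpr ⟨hpos, hle, (Int.modEq_iff_dvd.mpr hdvd).trans hmod⟩]

theorem eq_zpow_liuTop_sub {β : kˣ} (i : ℤ) (h : (β : k) ^ n = 1) :
    (β : k) = γ ^ (liuTop n γ β i - i) := by
  obtain ⟨j, _, hj⟩ := hγ.out.eq_pow_of_pow_eq_one h
  have hj' : (β : k) = γ ^ (j : ℤ) := by rw [zpow_natCast, hj]
  obtain ⟨-, hle, hmod⟩ := (liuPhi_unique n (-i - j) _).mp rfl
  rw [liuTop_eq_of_eq_zpow i hj', Nat.cast_sub hle, hj', ← div_eq_one_iff_eq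
    (zpow_ne_zero _ (hγ.out.ne_zero (NeZero.ne n))), ← zpow_sub₀ (hγ.out.ne_zero (NeZero.ne n)),
    hγ.out.zpow_eq_one_iff_dvd]
  rw [show (j : ℤ) - (n - liuPhi n (-i - j) - i) = liuPhi n (-i - j) - (-i - j) - n by ring]
  exact dvd_sub_self_right.mpr (Int.modEq_iff_dvd.mp hmod)

end PrimitiveRoot

namespace LiuAlgebra

variable {k : Type*} [Field k] {n w : ℕ} {γ : k} [NeZero n]

theorem y_pow_mul_xg_mul_ginv (d : ℕ) (r i : ℤ) :
    y n w γ ^ d * xg n w γ r i * ginv n w γ = y n w γ ^ d * xg n w γ r (i - 1) := by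
  rw [mul_assoc, ginv_eq_xg, xg_mul, add_zero, ← sub_eq_add_neg]

variable [hγ : Fact (IsPrimitiveRoot γ n)]

section CoactionCoeff

theorem coactionCoeff_of_lt (β : kˣ) (r i : ℤ) {a l : ℕ} (h : a < l) :
    coactionCoeff n w γ β r i a l = 0 := by
  cases a with
  | zero =>
    cases l with
    | zero => omega
    | succ l => rw [coactionCoeff]
  | succ a =>
    cases l with
    | zero => omega
    | succ l => rw [coactionCoeff, if_neg (by omega), if_neg (by omega)]

theorem coactionCoeff_succ_zero (β : kˣ) (r i : ℤ) (a : ℕ) :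
    coactionCoeff n w γ β r i (a + 1) 0 =
      coactionCoeff n w γ β r i a 0 * HopfAlgebra.antipode k (y n w γ) +
        (β : k) • (y n w γ * coactionCoeff n w γ β r i a 0 * ginv n w γ) := by
  rw [coactionCoeff, antipode_g]

theorem coactionCoeff_succ_succ (β : kˣ) (r i : ℤ) (a l : ℕ) :
    coactionCoeff n w γ β r i (a + 1) (l + 1) =
      coactionCoeff n w γ β r i a (l + 1) * HopfAlgebra.antipode k (y n w γ) +
        ((β : k) * γ ^ (-((l + 1 : ℕ) : ℤ))) •
          (y n w γ * coactionCoeff n w γ β r i a (l + 1) * ginv n w γ) +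
        coactionCoeff n w γ β r i a l * ginv n w γ := by
  rw [coactionCoeff]
  split_ifs with hlt heq
  · rw [antipode_g]
  · obtain rfl : l = a := by omega
    rw [coactionCoeff_of_lt β r i (Nat.lt_succ_self l), antipode_g]
    simp
  · rw [coactionCoeff_of_lt β r i (show a < l + 1 by omega),
      coactionCoeff_of_lt β r i (show a < l by omega)]
    simp

theorem coactionCoeff_self (β : kˣ) (r i : ℤ) (a : ℕ) :
    coactionCoeff n w γ β r i a a = xg n w γ r (i - a) := by
  induction a with
  | zero => simp [coactionCoeff]
  | succ a ih =>
    rw [coactionCoeff_succ_succ, coactionCoeff_of_lt β r i (Nat.lt_succ_self a), ih, ginv_eq_xg,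
      xg_mul, zero_mul, mul_zero, zero_mul, smul_zero, zero_add, zero_add, add_zero,
      Nat.cast_succ, ← sub_sub]
    rfl

/-- The scalar `s` in the closed form `c(d + l, l) = s y^d x^r g^{i-d-l}` of the coefficients of
the coaction. -/
noncomputable def coeffScalar (γ b : k) (i : ℤ) (d l : ℕ) : k :=
  qBinomAux γ⁻¹ d l * ∏ s ∈ Finset.range d, (b - γ ^ ((l : ℤ) + s - i))

theorem coeffScalar_zero_right (γ b : k) (i : ℤ) (d : ℕ) :
    coeffScalar γ b i d 0 = ∏ s ∈ Finset.range d, (b - γ ^ ((s : ℤ) - i)) := by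
  simp [coeffScalar, qBinomAux_zero_right]

theorem coeffScalar_succ_zero (γ b : k) (i : ℤ) (d : ℕ) :
    coeffScalar γ b i (d + 1) 0 = coeffScalar γ b i d 0 * (b - γ ^ (-(i - d))) := by
  rw [coeffScalar_zero_right, coeffScalar_zero_right, Finset.prod_range_succ, neg_sub]

theorem coeffScalar_succ_succ {γ : k} (hγ : γ ≠ 0) (b : k) (i : ℤ) (d l : ℕ) :
    coeffScalar γ b i (d + 1) (l + 1) =
      coeffScalar γ b i d (l + 1) *
        (b * γ ^ (-((l + 1 : ℕ) : ℤ)) - γ ^ (-(i - (d + (l + 1) : ℕ)))) +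
      coeffScalar γ b i (d + 1) l := by
  have hsplit : ∏ s ∈ Finset.range (d + 1), (b - γ ^ ((l : ℤ) + s - i)) =
      (∏ s ∈ Finset.range d, (b - γ ^ (((l + 1 : ℕ) : ℤ) + s - i))) *
        (b - γ ^ ((l : ℤ) - i)) := by
    rw [Finset.prod_range_succ', Nat.cast_zero, add_zero]
    refine congrArg₂ _ (Finset.prod_congr rfl fun s _ => ?_) rfl
    rw [Nat.cast_succ, Nat.cast_succ, add_right_comm, ← add_assoc]
  have hpow : γ ^ (-(i - (d + (l + 1) : ℕ))) = γ ^ (d + 1) * γ ^ ((l : ℤ) - i) := by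
    rw [← zpow_natCast, ← zpow_add₀ hγ]
    congr 1
    push_cast
    ring
  have htop : γ ^ (((l + 1 : ℕ) : ℤ) + d - i) = γ ^ (d + 1) * γ ^ ((l : ℤ) - i) := by
    rw [← hpow]
    congr 1
    push_cast
    ring
  have hinv : γ ^ (-((l + 1 : ℕ) : ℤ)) = γ⁻¹ ^ (l + 1) := by
    rw [zpow_neg, zpow_natCast, inv_pow]
  have hcancel : γ ^ (d + 1) * γ⁻¹ ^ (d + 1) = 1 := by
    rw [← mul_pow, mul_inv_cancel₀ hγ, one_pow]
  rw [coeffScalar, coeffScalar, coeffScalar, hsplit, Finset.prod_range_succ, hpow, htop, hinv]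
  set P := ∏ s ∈ Finset.range d, (b - γ ^ (((l + 1 : ℕ) : ℤ) + s - i))
  linear_combination (b * P) * qBinomAux_succ_succ_left γ⁻¹ d l -
    (P * γ ^ (d + 1) * γ ^ ((l : ℤ) - i)) * qBinomAux_succ_succ γ⁻¹ d l -
    (P * γ ^ ((l : ℤ) - i) * qBinomAux γ⁻¹ (d + 1) l) * hcancel

theorem mul_antipode_y_add_smul_y_mul_ginv (b : k) (d : ℕ) (r i : ℤ) :
    y n w γ ^ d * xg n w γ r i * HopfAlgebra.antipode k (y n w γ) +
        b • (y n w γ * (y n w γ ^ d * xg n w γ r i) * ginv n w γ) =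
      (b - γ ^ (-i)) • (y n w γ ^ (d + 1) * xg n w γ r (i - 1)) := by
  have hS : y n w γ ^ d * xg n w γ r i * HopfAlgebra.antipode k (y n w γ) =
      -γ ^ (-i) • (y n w γ ^ (d + 1) * xg n w γ r (i - 1)) := by
    rw [antipode_y, mul_neg, ← mul_assoc, mul_assoc (y n w γ ^ d),
      xg_mul_y (gamma_ne_zero n γ), mul_smul_comm, smul_mul_assoc, ← mul_assoc, ← pow_succ,
      y_pow_mul_xg_mul_ginv, neg_smul]
  rw [hS, ← mul_assoc, ← pow_succ', y_pow_mul_xg_mul_ginv, ← add_smul, neg_add_eq_sub]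

theorem coactionCoeff_eq (β : kˣ) (r i : ℤ) (d l : ℕ) :
    coactionCoeff n w γ β r i (d + l) l =
      coeffScalar γ β i d l • (y n w γ ^ d * xg n w γ r (i - (d + l : ℕ))) := by
  induction l generalizing d with
  | zero =>
    induction d with
    | zero => simp [coeffScalar, qBinomAux_zero_right, coactionCoeff]
    | succ d ih =>
      rw [add_zero] at ih ⊢
      rw [coactionCoeff_succ_zero, ih, smul_mul_assoc, mul_smul_comm, smul_mul_assoc,
        smul_comm (β : k), ← smul_add, mul_antipode_y_add_smul_y_mul_ginv, smul_smul,
        coeffScalar_succ_zero, Nat.cast_succ, sub_sub]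
  | succ l ihl =>
    induction d with
    | zero => simp [coeffScalar, qBinomAux_zero_left, coactionCoeff_self]
    | succ d ihd =>
      have hl : coactionCoeff n w γ β r i (d + (l + 1)) l = coeffScalar γ β i (d + 1) l •
          (y n w γ ^ (d + 1) * xg n w γ r (i - (d + (l + 1) : ℕ))) := by
        rw [show d + (l + 1) = d + 1 + l by omega]
        exact ihl (d + 1)
      have hi : i - ((d + (l + 1) : ℕ) : ℤ) - 1 = i - ((d + 1 + (l + 1) : ℕ) : ℤ) := by
        push_cast
        ring
      rw [show d + 1 + (l + 1) = d + (l + 1) + 1 by omega] at hi ⊢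
      rw [coactionCoeff_succ_succ, ihd, hl, smul_mul_assoc, mul_smul_comm, smul_mul_assoc,
        smul_comm (_ * _ : k), ← smul_add, mul_antipode_y_add_smul_y_mul_ginv, smul_mul_assoc,
        y_pow_mul_xg_mul_ginv, smul_smul, ← add_smul, hi,
        coeffScalar_succ_succ (gamma_ne_zero n γ)]

end CoactionCoeff

section Top

theorem coeffScalar_ne_zero {β : kˣ} {i : ℤ} {d : ℕ} (hd : d ≤ liuTop n γ β i) :
    coeffScalar γ β i d 0 ≠ 0 := by
  rw [coeffScalar_zero_right, Finset.prod_ne_zero_iff]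
  intro s hs h
  have hsd : s < d := Finset.mem_range.mp hs
  have hlt : liuTop n γ β i < n := liuTop_lt β i
  have hone : (β : k) ^ n = 1 := by
    rw [sub_eq_zero.mp h, ← zpow_natCast, zpow_comm, zpow_natCast, hγ.out.pow_eq_one, one_zpow]
  have heq : liuTop n γ β i = s :=
    eq_of_zpow_natCast_sub_eq hγ.out hlt (by omega)
      ((eq_zpow_liuTop_sub i hone).symm.trans (sub_eq_zero.mp h))
  omega

theorem coeffScalar_eq_zero_of_pow_eq_one {β : kˣ} {i : ℤ} (h : (β : k) ^ n = 1) {d l : ℕ}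
    (hl : l ≤ liuTop n γ β i) (hd : liuTop n γ β i + 1 = d + l) : coeffScalar γ β i d l = 0 := by
  have hmem : liuTop n γ β i - l ∈ Finset.range d := Finset.mem_range.mpr (by omega)
  rw [coeffScalar, Finset.prod_eq_zero hmem, mul_zero]
  rw [Nat.cast_sub hl, add_sub_cancel, ← eq_zpow_liuTop_sub i h, sub_self]

theorem coactionCoeff_liuTop_succ (β : kˣ) (r i : ℤ) {l : ℕ} (hl0 : l ≠ 0)
    (hl : l ≤ liuTop n γ β i) : coactionCoeff n w γ β r i (liuTop n γ β i + 1) l = 0 := by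
  obtain ⟨d, hd⟩ : ∃ d, liuTop n γ β i + 1 = d + l := Nat.exists_eq_add_of_le' (by omega)
  rw [hd, coactionCoeff_eq]
  by_cases h : (β : k) ^ n = 1
  · rw [coeffScalar_eq_zero_of_pow_eq_one h hl hd, zero_smul]
  · have hn : liuTop n γ β i + 1 = n := liuTop_eq_of_pow_ne_one i h
    obtain ⟨l, rfl⟩ := Nat.exists_eq_succ_of_ne_zero hl0
    rw [coeffScalar, qBinomAux_eq_zero hγ.out.inv l d (by omega) (by omega), zero_mul, zero_smul]

theorem coactionCoeff_liuTop_succ_zero (β : kˣ) (r i : ℤ) :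
    coactionCoeff n w γ β r i (liuTop n γ β i + 1) 0 =
      (1 - (β : k) ^ n) • (xg n w γ r i - xg n w γ r (i - (liuTop n γ β i + 1 : ℕ))) := by
  rw [← add_zero (liuTop n γ β i + 1), coactionCoeff_eq, add_zero]
  by_cases h : (β : k) ^ n = 1
  · rw [coeffScalar_eq_zero_of_pow_eq_one h (Nat.zero_le _) rfl, h, sub_self, zero_smul, zero_smul]
  · rw [liuTop_eq_of_pow_ne_one i h, coeffScalar_zero_right, prod_range_sub_zpow hγ.out, y_pow,
      ← g_pow, g_pow_eq_xg, sub_mul, one_mul, xg_mul, zero_add, add_sub_cancel,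
      ← neg_sub (1 : k), neg_smul, ← smul_neg, neg_sub]

theorem liuTop_eq_of_xg_eq [NeZero w] (β : kˣ) {r i r' i' : ℤ}
    (h : xg n w γ r i = xg n w γ r' i') : liuTop n γ β i = liuTop n γ β i' := by
  by_cases hβ : (β : k) ^ n = 1
  · have hγ0 : γ ≠ 0 := gamma_ne_zero n γ
    have hpow : γ ^ ((liuTop n γ β i : ℤ) - i) = γ ^ ((liuTop n γ β i' : ℤ) - i) := by
      rw [← eq_zpow_liuTop_sub (γ := γ) i hβ, eq_zpow_liuTop_sub (γ := γ) i' hβ, zpow_sub₀ hγ0,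
        zpow_sub₀ hγ0, zpow_eq_zpow_of_xg_eq h]
    exact eq_of_zpow_natCast_sub_eq hγ.out (liuTop_lt β i) (liuTop_lt β i') hpow
  · have hi : liuTop n γ β i + 1 = n := liuTop_eq_of_pow_ne_one i hβ
    have hi' : liuTop n γ β i' + 1 = n := liuTop_eq_of_pow_ne_one i' hβ
    omega

end Top

end LiuAlgebra

/-! ## Morphisms and orbits of Yetter–Drinfeld modules -/

namespace ActionCoaction

universe u v v' x

variable {k : Type u} {H : Type x} {V : Type v} {W : Type v'} [Field k] [Ring H] [HopfAlgebra k H]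
  [AddCommGroup V] [Module k V] [AddCommGroup W] [Module k W]

section Twist

variable (act : H →ₐ[k] Module.End k V)

theorem ydTwist_mul (s t : H ⊗[k] (H ⊗[k] H)) :
    ydTwist k act (s * t) = ydTwist k act s * ydTwist k act t := by
  suffices h : (LinearMap.mul k (H ⊗[k] (H ⊗[k] H))).compr₂ (ydTwist k act) =
      (LinearMap.mul k (Module.End k (H ⊗[k] V))).compl₁₂ (ydTwist k act) (ydTwist k act) from
    LinearMap.congr_fun₂ h s t
  ext a b c a' b' c' u v
  simp [ydTwist_tmul, HopfAlgebra.antipode_mul_antidistrib, mul_assoc]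

/-- The left `H`-module structure `h • (u ⊗ v) = h₍₁₎ u S(h₍₃₎) ⊗ h₍₂₎ • v` on `H ⊗ V`; the
Yetter–Drinfeld compatibility says that the coaction is `H`-linear for it. -/
noncomputable def twist : H →ₐ[k] Module.End k (H ⊗[k] V) :=
  AlgHom.ofLinearMap
    (ydTwist k act ∘ₗ LinearMap.lTensor H Coalgebra.comul ∘ₗ Coalgebra.comul)
    (by
      ext u v
      simp [Algebra.TensorProduct.one_def, ydTwist_tmul])
    fun a b => by
      have hmul (s t : H ⊗[k] H) :
          LinearMap.lTensor H (Coalgebra.comul : H →ₗ[k] H ⊗[k] H) (s * t) =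
            LinearMap.lTensor H Coalgebra.comul s * LinearMap.lTensor H Coalgebra.comul t :=
        map_mul (Algebra.TensorProduct.map (AlgHom.id k H) (Bialgebra.comulAlgHom k H)) s t
      simp only [LinearMap.comp_apply, Bialgebra.comul_mul, hmul, ydTwist_mul]

theorem twist_def (h : H) :
    twist act h = ydTwist k act (LinearMap.lTensor H Coalgebra.comul (Coalgebra.comul h)) :=
  rfl

theorem twist_tmul_of_isGroupLikeElem {h : H} (hh : IsGroupLikeElem k h) (u : H) (v : V) :
    twist act h (u ⊗ₜ v) = (h * u * HopfAlgebra.antipode k h) ⊗ₜ act h v := by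
  rw [twist_def, hh.comul_eq_tmul_self, LinearMap.lTensor_tmul, hh.comul_eq_tmul_self,
    ydTwist_tmul]

theorem twist_of_isGroupLikeElem_of_commute {z : H} (hz : IsGroupLikeElem k z)
    (hcomm : ∀ h, Commute z h) : twist act z = LinearMap.lTensor H (act z) := by
  ext u v
  simp [twist_tmul_of_isGroupLikeElem act hz, (hcomm u).eq, mul_assoc, hz.mul_antipode_cancel]

end Twist

theorem lTensor_twist {act : H →ₐ[k] Module.End k V} {act' : H →ₐ[k] Module.End k W}
    {f : V →ₗ[k] W} (hf : ∀ h v, f (act h v) = act' h (f v)) (h : H) (t : H ⊗[k] V) :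
    LinearMap.lTensor H f (twist act h t) = twist act' h (LinearMap.lTensor H f t) := by
  suffices hs : ∀ s, LinearMap.lTensor H f ∘ₗ ydTwist k act s =
      ydTwist k act' s ∘ₗ LinearMap.lTensor H f from LinearMap.congr_fun (hs _) t
  intro s
  suffices hL : (ydTwist k act).compr₂ (LinearMap.lTensor H f) =
      (ydTwist k act').compl₂ (LinearMap.lTensor H f) by
    exact LinearMap.congr_fun hL s
  ext a b c u v
  simp [ydTwist_tmul, hf]

/-- The left coaction `Δ ⊗ id` of `H` on `H ⊗ V`. -/
noncomputable def comulTensor (k : Type u) (H : Type x) (V : Type v) [Field k] [Ring H]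
    [HopfAlgebra k H] [AddCommGroup V] [Module k V] : H ⊗[k] V →ₗ[k] H ⊗[k] (H ⊗[k] V) :=
  (TensorProduct.assoc k H H V).toLinearMap ∘ₗ LinearMap.rTensor V Coalgebra.comul

theorem comulTensor_twist_of_isGroupLikeElem (act : H →ₐ[k] Module.End k V) {h : H}
    (hh : IsGroupLikeElem k h) (t : H ⊗[k] V) :
    comulTensor k H V (twist act h t) = twist (twist act) h (comulTensor k H V t) := by
  suffices hL : comulTensor k H V ∘ₗ twist act h =
      (twist (twist act) h).comp (comulTensor k H V) from LinearMap.congr_fun hL t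
  ext u v
  simp only [comulTensor, TensorProduct.AlgebraTensorModule.curry_apply,
    LinearMap.coe_restrictScalars, TensorProduct.curry_apply, LinearMap.comp_apply,
    LinearEquiv.coe_coe, twist_tmul_of_isGroupLikeElem act hh, LinearMap.rTensor_tmul,
    Bialgebra.comul_mul, hh.comul_eq_tmul_self, hh.antipode.comul_eq_tmul_self]
  induction Coalgebra.comul (R := k) u with
  | zero => simp
  | add s s' hs hs' => simp only [mul_add, add_mul, TensorProduct.add_tmul, map_add, hs, hs']
  | tmul p q => simp [twist_tmul_of_isGroupLikeElem _ hh]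

theorem lid_counit_twist_of_isGroupLikeElem (act : H →ₐ[k] Module.End k V) {h : H}
    (hh : IsGroupLikeElem k h) (t : H ⊗[k] V) :
    TensorProduct.lid k V (LinearMap.rTensor V Coalgebra.counit (twist act h t)) =
      act h (TensorProduct.lid k V (LinearMap.rTensor V Coalgebra.counit t)) := by
  induction t with
  | zero => simp
  | add s s' hs hs' => simp only [map_add, hs, hs']
  | tmul u v => simp [twist_tmul_of_isGroupLikeElem act hh, hh.counit_eq_one]

/-- A morphism of modules with action and coaction: a linear map which preserves both. -/
structure IsMorphism (M : ActionCoaction k H V) (N : ActionCoaction k H W) (f : V →ₗ[k] W) :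
    Prop where
  map_act : ∀ (h : H) (v : V), f (M.act h v) = N.act h (f v)
  map_coact : ∀ v : V, N.coact (f v) = LinearMap.lTensor H f (M.coact v)

variable {M : ActionCoaction k H V} {N : ActionCoaction k H W} {f : V →ₗ[k] W}

namespace IsMorphism

theorem isSubobject_ker (hf : IsMorphism M N f) : M.IsSubobject (LinearMap.ker f) := by
  refine ⟨fun h v hv => ?_, fun v hv => ?_⟩
  · rw [LinearMap.mem_ker] at hv ⊢
    rw [hf.map_act, hv, map_zero]
  · change M.coact v ∈ LinearMap.range
      (TensorProduct.AlgebraTensorModule.lTensor k H (LinearMap.ker f).subtype)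
    rw [← Module.Flat.ker_lTensor_eq, LinearMap.mem_ker]
    change LinearMap.lTensor H f (M.coact v) = 0
    rw [← hf.map_coact, LinearMap.mem_ker.mp hv, map_zero]

theorem isSubobject_range (hf : IsMorphism M N f) : N.IsSubobject (LinearMap.range f) := by
  refine ⟨?_, ?_⟩
  · rintro h _ ⟨v, rfl⟩
    exact ⟨_, hf.map_act h v⟩
  · rintro _ ⟨v, rfl⟩
    rw [hf.map_coact]
    refine ⟨LinearMap.lTensor H f.rangeRestrict (M.coact v), ?_⟩
    rw [← LinearMap.comp_apply, ← LinearMap.lTensor_comp]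
    rfl

theorem injective_of_simple (hf : IsMorphism M N f) (hM : M.IsSimpleYetterDrinfeld)
    (h0 : f ≠ 0) : Function.Injective f := by
  rcases hM.eq_bot_or_eq_top _ hf.isSubobject_ker with h | h
  · exact LinearMap.ker_eq_bot.mp h
  · exact absurd (LinearMap.ker_eq_top.mp h) h0

theorem surjective_of_simple (hf : IsMorphism M N f) (hN : N.IsSimpleYetterDrinfeld)
    (h0 : f ≠ 0) : Function.Surjective f := by
  rcases hN.eq_bot_or_eq_top _ hf.isSubobject_range with h | h
  · exact absurd (LinearMap.range_eq_bot.mp h) h0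
  · exact LinearMap.range_eq_top.mp h

theorem isomorphic (hf : IsMorphism M N f) (hM : M.IsSimpleYetterDrinfeld)
    (hN : N.IsSimpleYetterDrinfeld) (h0 : f ≠ 0) : M.Isomorphic N :=
  ⟨LinearEquiv.ofBijective f ⟨hf.injective_of_simple hM h0, hf.surjective_of_simple hN h0⟩,
    hf.map_act, hf.map_coact⟩

end IsMorphism

theorem Isomorphic.symm (h : M.Isomorphic N) : N.Isomorphic M := by
  obtain ⟨e, hact, hcoact⟩ := h
  refine ⟨e.symm, fun h v => ?_, fun v => ?_⟩
  · rw [e.symm_apply_eq, hact, e.apply_symm_apply]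
  · have hv := hcoact (e.symm v)
    rw [e.apply_symm_apply] at hv
    rw [hv, ← LinearMap.comp_apply, ← LinearMap.lTensor_comp]
    simp

namespace IsYetterDrinfeld

theorem coact_act (hM : M.IsYetterDrinfeld) (h : H) (v : V) :
    M.coact (M.act h v) = twist M.act h (M.coact v) :=
  hM.compat h v

theorem coact_act_of_isGroupLikeElem (hM : M.IsYetterDrinfeld) {z h : H}
    (hz : IsGroupLikeElem k z) (hzh : Commute z h) {v : V} (hv : M.coact v = h ⊗ₜ v) :
    M.coact (M.act z v) = h ⊗ₜ M.act z v := by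
  rw [hM.coact_act, hv, twist_tmul_of_isGroupLikeElem M.act hz, hzh.eq, mul_assoc,
    hz.mul_antipode_cancel, mul_one]

theorem isSubobject_orbit (hM : M.IsYetterDrinfeld) {v : V} {h : H} (hv : M.coact v = h ⊗ₜ v) :
    M.IsSubobject (LinearMap.range (M.act.toLinearMap.flip v)) := by
  refine ⟨?_, ?_⟩
  · rintro a _ ⟨b, rfl⟩
    exact ⟨a * b, by simp⟩
  · rintro _ ⟨a, rfl⟩
    have hv' : M.coact v = LinearMap.lTensor H (M.act.toLinearMap.flip v) (h ⊗ₜ 1) := by simp [hv]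
    have horbit (a b : H) : M.act.toLinearMap.flip v (Algebra.lmul k H a b) =
        M.act a (M.act.toLinearMap.flip v b) := by simp
    rw [LinearMap.flip_apply, AlgHom.toLinearMap_apply, hM.coact_act, hv', ← lTensor_twist horbit]
    refine ⟨LinearMap.lTensor H (M.act.toLinearMap.flip v).rangeRestrict
      (twist (Algebra.lmul k H) a (h ⊗ₜ 1)), ?_⟩
    rw [← LinearMap.comp_apply, ← LinearMap.lTensor_comp]
    rfl

theorem isMorphism_act_sub_smul (hM : M.IsYetterDrinfeld) {z : H} (hz : IsGroupLikeElem k z)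
    (hcomm : ∀ h, Commute z h) (c : k) : IsMorphism M M (M.act z - c • 1) where
  map_act h v := by
    have hzh : M.act z (M.act h v) = M.act h (M.act z v) := by
      rw [← Module.End.mul_apply, ← Module.End.mul_apply, ← map_mul, ← map_mul, hcomm h]
    simp [hzh]
  map_coact v := by
    simp [hM.coact_act, twist_of_isGroupLikeElem_of_commute M.act hz hcomm,
      LinearMap.lTensor_sub, LinearMap.lTensor_smul, Module.End.one_eq_id]

end IsYetterDrinfeld

theorem IsSimpleYetterDrinfeld.exists_act_eq (hM : M.IsSimpleYetterDrinfeld) {v : V} (hv0 : v ≠ 0)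
    {h : H} (hv : M.coact v = h ⊗ₜ v) (u : V) : ∃ a, M.act a v = u := by
  rcases hM.eq_bot_or_eq_top _ (hM.isYetterDrinfeld.isSubobject_orbit hv) with hbot | htop
  · have hmem : v ∈ LinearMap.range (M.act.toLinearMap.flip v) := ⟨1, by simp⟩
    rw [hbot, Submodule.mem_bot] at hmem
    exact absurd hmem hv0
  · exact LinearMap.mem_range.mp (htop ▸ Submodule.mem_top)

theorem IsSimpleYetterDrinfeld.act_eq_smul (hM : M.IsSimpleYetterDrinfeld) {z : H}
    (hz : IsGroupLikeElem k z) (hcomm : ∀ h, Commute z h) {c : k}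
    (hc : ¬ Function.Surjective (M.act z - c • 1 : Module.End k V)) : M.act z = c • 1 := by
  by_contra h
  exact hc ((hM.isYetterDrinfeld.isMorphism_act_sub_smul hz hcomm c).surjective_of_simple hM
    (sub_ne_zero.mpr h))

end ActionCoaction

/-! ## The Yetter–Drinfeld condition on generators -/

namespace LiuAlgebra

open ActionCoaction

universe u v

variable {k : Type u} [Field k] {n w : ℕ} {γ : k}

theorem commute_x (a : LiuAlgebra n w γ) : Commute (x n w γ) a := by
  induction a using induction with
  | hc c => exact (Algebra.commutes c _).symm
  | hx => exact Commute.refl _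
  | hx' => exact (x_mul_xinv n w γ).trans (xinv_mul_x n w γ).symm
  | hg => exact commute_x_g n w γ
  | hy => exact x_mul_y n w γ
  | hadd a b ha hb => exact ha.add_right hb
  | hmul a b ha hb => exact ha.mul_right hb

theorem map_act_of_generators {E F : Type*} [AddCommGroup E] [Module k E] [AddCommGroup F]
    [Module k F] {ρ : LiuAlgebra n w γ →ₐ[k] Module.End k E}
    {ρ' : LiuAlgebra n w γ →ₐ[k] Module.End k F} {f : E →ₗ[k] F}
    (hx : ∀ v, f (ρ (x n w γ) v) = ρ' (x n w γ) (f v))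
    (hg : ∀ v, f (ρ (g n w γ) v) = ρ' (g n w γ) (f v))
    (hy : ∀ v, f (ρ (y n w γ) v) = ρ' (y n w γ) (f v)) (h : LiuAlgebra n w γ) (v : E) :
    f (ρ h v) = ρ' h (f v) := by
  induction h using induction generalizing v with
  | hc c => simp
  | hx => exact hx v
  | hx' =>
    have hE : ρ (x n w γ) (ρ (xinv n w γ) v) = v := by
      rw [← Module.End.mul_apply, ← map_mul, x_mul_xinv, map_one, Module.End.one_apply]
    have hF (u : F) : ρ' (xinv n w γ) (ρ' (x n w γ) u) = u := by
      rw [← Module.End.mul_apply, ← map_mul, xinv_mul_x, map_one, Module.End.one_apply]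
    conv_rhs => rw [← hE, hx, hF]
  | hg => exact hg v
  | hy => exact hy v
  | hadd a b ha hb => simp only [map_add, LinearMap.add_apply, ha, hb]
  | hmul a b ha hb => rw [map_mul, map_mul, Module.End.mul_apply, Module.End.mul_apply, ha, hb]

theorem act_y_act_y_pow {E : Type*} [AddCommGroup E] [Module k E]
    (act : LiuAlgebra n w γ →ₐ[k] Module.End k E) (v : E) (a : ℕ) :
    act (y n w γ) (act (y n w γ ^ a) v) = act (y n w γ ^ (a + 1)) v := by
  rw [pow_succ', map_mul, Module.End.mul_apply]

variable [NeZero n] [hγ : Fact (IsPrimitiveRoot γ n)]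

theorem isGroupLikeElem_x : IsGroupLikeElem k (x n w γ) :=
  x_eq_xg (n := n) (w := w) (γ := γ) ▸ isGroupLikeElem_xg 1 0

theorem isGroupLikeElem_g : IsGroupLikeElem k (g n w γ) :=
  g_eq_xg (n := n) (w := w) (γ := γ) ▸ isGroupLikeElem_xg 0 1

section Twist

variable {E : Type v} [AddCommGroup E] [Module k E] (act : LiuAlgebra n w γ →ₐ[k] Module.End k E)

theorem twist_y (u : LiuAlgebra n w γ) (v : E) :
    twist act (y n w γ) (u ⊗ₜ v) = (y n w γ * u * ginv n w γ) ⊗ₜ act (g n w γ) v +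
      ((u * ginv n w γ) ⊗ₜ act (y n w γ) v +
        (u * HopfAlgebra.antipode k (y n w γ)) ⊗ₜ v) := by
  simp [twist_def, isGroupLikeElem_g.comul_eq_tmul_self, comul_y, ydTwist_tmul, antipode_g,
    TensorProduct.tmul_add]

theorem comulTensor_twist (h : LiuAlgebra n w γ) (t : LiuAlgebra n w γ ⊗[k] E) :
    comulTensor k _ E (twist act h t) = twist (twist act) h (comulTensor k _ E t) := by
  refine map_act_of_generators (comulTensor_twist_of_isGroupLikeElem act isGroupLikeElem_x)
    (comulTensor_twist_of_isGroupLikeElem act isGroupLikeElem_g) (fun t => ?_) h t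
  have hginv : Coalgebra.comul (R := k) (ginv n w γ) = ginv n w γ ⊗ₜ ginv n w γ := by
    rw [ginv_eq_xg, (isGroupLikeElem_xg 0 (-1)).comul_eq_tmul_self]
  induction t with
  | zero => simp
  | add s s' hs hs' => simp only [map_add, hs, hs']
  | tmul u v =>
    simp only [comulTensor, LinearMap.comp_apply, LinearEquiv.coe_coe, twist_y, map_add,
      LinearMap.rTensor_tmul, Bialgebra.comul_mul, comul_y, hginv, antipode_y, mul_neg, map_neg]
    induction Coalgebra.comul (R := k) u with
    | zero => simp
    | add s s' hs hs' =>
      simp only [mul_add, add_mul, TensorProduct.add_tmul, map_add, neg_add] at hs hs' ⊢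
      rw [← hs, ← hs']
      abel
    | tmul p q =>
      simp only [add_mul, mul_add, Algebra.TensorProduct.tmul_mul_tmul, TensorProduct.add_tmul,
        map_add, TensorProduct.assoc_tmul, twist_tmul_of_isGroupLikeElem act isGroupLikeElem_g,
        antipode_g, twist_y, one_mul, mul_one, TensorProduct.neg_tmul, TensorProduct.tmul_neg,
        TensorProduct.tmul_add, antipode_y, mul_neg, map_neg, neg_add, g_mul_ginv, mul_assoc]
      abel

theorem lid_counit_twist (h : LiuAlgebra n w γ) (t : LiuAlgebra n w γ ⊗[k] E) :
    TensorProduct.lid k E (LinearMap.rTensor E Coalgebra.counit (twist act h t)) =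
      act h (TensorProduct.lid k E (LinearMap.rTensor E Coalgebra.counit t)) := by
  refine map_act_of_generators
    (f := (TensorProduct.lid k E).toLinearMap ∘ₗ LinearMap.rTensor E Coalgebra.counit)
    (lid_counit_twist_of_isGroupLikeElem act isGroupLikeElem_x)
    (lid_counit_twist_of_isGroupLikeElem act isGroupLikeElem_g) (fun t => ?_) h t
  have hy : Coalgebra.counit (R := k) (y n w γ) = 0 := counitHom_y n w γ
  have hginv : Coalgebra.counit (R := k) (ginv n w γ) = 1 := by
    rw [ginv_eq_xg, (isGroupLikeElem_xg 0 (-1)).counit_eq_one]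
  induction t with
  | zero => simp
  | add s s' hs hs' => simp only [map_add, hs, hs']
  | tmul u v => simp [twist_y, hy, hginv]

theorem isYetterDrinfeld_of_generator {M : ActionCoaction k (LiuAlgebra n w γ) E}
    (hcompat : ∀ h v, M.coact (M.act h v) = twist M.act h (M.coact v)) {v : E}
    (hgen : ∀ u, ∃ a, M.act a v = u) {h : LiuAlgebra n w γ} (hh : IsGroupLikeElem k h)
    (hv : M.coact v = h ⊗ₜ v) : M.IsYetterDrinfeld where
  coassoc u := by
    obtain ⟨a, rfl⟩ := hgen u
    change comulTensor k _ E (M.coact (M.act a v)) = _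
    rw [hcompat, comulTensor_twist, lTensor_twist hcompat, hv]
    simp [comulTensor, hh.comul_eq_tmul_self, hv]
  counit_coact u := by
    obtain ⟨a, rfl⟩ := hgen u
    rw [hcompat, lid_counit_twist, hv]
    simp [hh.counit_eq_one]
  compat := hcompat

end Twist

section YString

variable {E : Type v} [AddCommGroup E] [Module k E]

theorem act_g_act_y_pow (act : LiuAlgebra n w γ →ₐ[k] Module.End k E) {b : k} {v : E}
    (hv : act (g n w γ) v = b • v) (a : ℕ) :
    act (g n w γ) (act (y n w γ ^ a) v) = (b * γ ^ (-(a : ℤ))) • act (y n w γ ^ a) v := by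
  rw [← Module.End.mul_apply, ← map_mul, g_eq_xg, xg_mul_y_pow (gamma_ne_zero n γ), map_smul,
    map_mul, LinearMap.smul_apply, Module.End.mul_apply, ← g_eq_xg, hv, map_smul, smul_smul,
    mul_comm, neg_one_mul]

theorem twist_y_sum_coactionCoeff (act : LiuAlgebra n w γ →ₐ[k] Module.End k E) {β : kˣ}
    (r i : ℤ) {v : E} (hg : act (g n w γ) v = (β : k) • v) (a : ℕ) :
    twist act (y n w γ) (∑ l ∈ Finset.range (a + 1),
        coactionCoeff n w γ β r i a l ⊗ₜ[k] act (y n w γ ^ l) v) =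
      ∑ l ∈ Finset.range (a + 2),
        coactionCoeff n w γ β r i (a + 1) l ⊗ₜ[k] act (y n w γ ^ l) v := by
  let c := coactionCoeff n w γ β r i
  let diag (l : ℕ) : LiuAlgebra n w γ := c a l * HopfAlgebra.antipode k (y n w γ) +
    ((β : k) * γ ^ (-(l : ℤ))) • (y n w γ * c a l * ginv n w γ)
  have hterm (l : ℕ) : twist act (y n w γ) (c a l ⊗ₜ[k] act (y n w γ ^ l) v) =
      diag l ⊗ₜ act (y n w γ ^ l) v + (c a l * ginv n w γ) ⊗ₜ act (y n w γ ^ (l + 1)) v := by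
    rw [twist_y, act_g_act_y_pow act hg, act_y_act_y_pow, TensorProduct.tmul_smul,
      TensorProduct.add_tmul, TensorProduct.smul_tmul']
    abel
  have hzero : c (a + 1) 0 = diag 0 := by simp [c, diag, coactionCoeff_succ_zero]
  have hsucc (l : ℕ) : c (a + 1) (l + 1) = diag (l + 1) + c a l * ginv n w γ :=
    coactionCoeff_succ_succ β r i a l
  have htop : diag (a + 1) = 0 := by
    simp [diag, c, coactionCoeff_of_lt β r i (Nat.lt_succ_self a)]
  calc twist act (y n w γ) (∑ l ∈ Finset.range (a + 1), c a l ⊗ₜ[k] act (y n w γ ^ l) v)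
      = ∑ l ∈ Finset.range (a + 1), diag l ⊗ₜ act (y n w γ ^ l) v +
          ∑ l ∈ Finset.range (a + 1),
            (c a l * ginv n w γ) ⊗ₜ act (y n w γ ^ (l + 1)) v := by
        rw [map_sum, ← Finset.sum_add_distrib]
        exact Finset.sum_congr rfl fun l _ => hterm l
    _ = ∑ l ∈ Finset.range (a + 2), diag l ⊗ₜ act (y n w γ ^ l) v +
          ∑ l ∈ Finset.range (a + 1),
            (c a l * ginv n w γ) ⊗ₜ act (y n w γ ^ (l + 1)) v := by
        rw [Finset.sum_range_succ _ (a + 1), htop, TensorProduct.zero_tmul, add_zero]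
    _ = ∑ l ∈ Finset.range (a + 2), c (a + 1) l ⊗ₜ act (y n w γ ^ l) v := by
        rw [Finset.sum_range_succ', Finset.sum_range_succ' (fun l => c (a + 1) l ⊗ₜ[k] _), hzero,
          add_right_comm, ← Finset.sum_add_distrib]
        simp only [hsucc, TensorProduct.add_tmul]

theorem coact_act_y_pow {M : ActionCoaction k (LiuAlgebra n w γ) E} (hM : M.IsYetterDrinfeld)
    {β : kˣ} {r i : ℤ} {v : E} (hg : M.act (g n w γ) v = (β : k) • v)
    (hv : M.coact v = xg n w γ r i ⊗ₜ v) (a : ℕ) :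
    M.coact (M.act (y n w γ ^ a) v) = ∑ l ∈ Finset.range (a + 1),
      coactionCoeff n w γ β r i a l ⊗ₜ[k] M.act (y n w γ ^ l) v := by
  induction a with
  | zero => simp [coactionCoeff, hv]
  | succ a ih =>
    rw [← act_y_act_y_pow, hM.coact_act, ih, twist_y_sum_coactionCoeff M.act r i hg]

end YString

theorem g_mul_coactionCoeff_mul_ginv (β : kˣ) (r i : ℤ) {a l : ℕ} (h : l ≤ a) :
    g n w γ * coactionCoeff n w γ β r i a l * ginv n w γ =
      γ ^ ((l : ℤ) - a) • coactionCoeff n w γ β r i a l := by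
  obtain ⟨d, rfl⟩ := Nat.exists_eq_add_of_le' h
  have hexp : (-1 * d : ℤ) = l - (d + l : ℕ) := by push_cast; ring
  rw [coactionCoeff_eq, mul_smul_comm, smul_mul_assoc, ← mul_assoc, g_eq_xg,
    xg_mul_y_pow (gamma_ne_zero n γ), smul_mul_assoc, smul_mul_assoc, smul_comm, hexp,
    mul_assoc (y n w γ ^ d), xg_mul, y_pow_mul_xg_mul_ginv, zero_add, add_sub_cancel_left]

section V

variable (α β : kˣ) (r i : ℤ) (hαβ : α ^ w = β ^ n)

theorem V_act_y_pow_single_zero {l : ℕ} (hl : l < liuTop n γ β i + 1) :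
    (V n w γ α β r i hαβ).act (y n w γ ^ l) (Pi.single 0 1) = Pi.single ⟨l, hl⟩ 1 := by
  induction l with
  | zero => simp
  | succ l ih =>
    rw [← act_y_act_y_pow, ih (Nat.lt_of_succ_lt hl), V_act_y,
      dif_pos (Nat.lt_of_succ_lt_succ hl)]

theorem V_act_y_pow_top_succ :
    (V n w γ α β r i hαβ).act (y n w γ ^ (liuTop n γ β i + 1)) (Pi.single 0 1) =
      (1 - (β : k) ^ n) • Pi.single 0 1 := by
  rw [← act_y_act_y_pow, V_act_y_pow_single_zero α β r i hαβ (Nat.lt_succ_self _), V_act_y,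
    dif_neg (lt_irrefl _)]

theorem V_act_g_single_zero :
    (V n w γ α β r i hαβ).act (g n w γ) (Pi.single 0 1) = (β : k) • Pi.single 0 1 := by
  simp [V_act_g]

theorem V_coact_single_zero :
    (V n w γ α β r i hαβ).coact (Pi.single 0 1) = xg n w γ r i ⊗ₜ Pi.single 0 1 := by
  rw [V_coact, Finset.sum_eq_single_of_mem 0 (by simp)]
  · simp [coactionCoeff]
  · intro l hl hl0
    simp_all

theorem exists_V_act_single_zero_eq (v : Fin (liuTop n γ β i + 1) → k) :
    ∃ a, (V n w γ α β r i hαβ).act a (Pi.single 0 1) = v := by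
  suffices h : LinearMap.range ((V n w γ α β r i hαβ).act.toLinearMap.flip (Pi.single 0 1)) = ⊤ from
    LinearMap.range_eq_top.mp h v
  rw [eq_top_iff, ← (Pi.basisFun k _).span_eq, Submodule.span_le]
  rintro _ ⟨j, rfl⟩
  exact ⟨y n w γ ^ (j : ℕ), by
    simpa using V_act_y_pow_single_zero α β r i hαβ j.2⟩

theorem V_coact_act_y_pow_of_le {a : ℕ} (ha : a ≤ liuTop n γ β i) :
    (V n w γ α β r i hαβ).coact ((V n w γ α β r i hαβ).act (y n w γ ^ a) (Pi.single 0 1)) =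
      ∑ l ∈ Finset.range (a + 1), coactionCoeff n w γ β r i a l ⊗ₜ[k]
        (V n w γ α β r i hαβ).act (y n w γ ^ l) (Pi.single 0 1) := by
  rw [V_act_y_pow_single_zero α β r i hαβ (Nat.lt_succ_of_le ha), V_coact]
  refine Finset.sum_nbij (fun l => (l : ℕ)) (fun l hl => ?_) Fin.val_injective.injOn
    (fun l hl => ?_) fun l _ => ?_
  · simpa [Fin.le_def, Nat.lt_succ_iff] using hl
  · have hla : l < a + 1 := by simpa using hl
    exact ⟨⟨l, by omega⟩, by simpa [Fin.le_def, Nat.lt_succ_iff] using hla, rfl⟩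
  · rw [V_act_y_pow_single_zero α β r i hαβ l.2]

theorem V_coact_act_y_pow_top_succ :
    (V n w γ α β r i hαβ).coact
        ((V n w γ α β r i hαβ).act (y n w γ ^ (liuTop n γ β i + 1)) (Pi.single 0 1)) =
      ∑ l ∈ Finset.range (liuTop n γ β i + 2),
        coactionCoeff n w γ β r i (liuTop n γ β i + 1) l ⊗ₜ[k]
          (V n w γ α β r i hαβ).act (y n w γ ^ l) (Pi.single 0 1) := by
  have hzero (l : ℕ) (hl : l ∈ Finset.range (liuTop n γ β i)) :
      coactionCoeff n w γ β r i (liuTop n γ β i + 1) (l + 1) ⊗ₜ[k]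
        (V n w γ α β r i hαβ).act (y n w γ ^ (l + 1)) (Pi.single 0 1) = 0 := by
    rw [coactionCoeff_liuTop_succ β r i (Nat.succ_ne_zero l)
      (Nat.succ_le_of_lt (Finset.mem_range.mp hl)), TensorProduct.zero_tmul]
  rw [Finset.sum_range_succ, Finset.sum_range_succ', Finset.sum_eq_zero hzero, zero_add,
    coactionCoeff_liuTop_succ_zero, coactionCoeff_self, V_act_y_pow_top_succ, pow_zero, map_one,
    Module.End.one_apply, map_smul, V_coact_single_zero, TensorProduct.tmul_smul,
    ← TensorProduct.smul_tmul', ← smul_add, ← TensorProduct.add_tmul, sub_add_cancel]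

theorem V_linearMap_congr {E : Type*} [AddCommGroup E] [Module k E]
    {f f' : (Fin (liuTop n γ β i + 1) → k) →ₗ[k] E}
    (h : ∀ l ≤ liuTop n γ β i,
      f ((V n w γ α β r i hαβ).act (y n w γ ^ l) (Pi.single 0 1)) =
        f' ((V n w γ α β r i hαβ).act (y n w γ ^ l) (Pi.single 0 1)))
    (v : Fin (liuTop n γ β i + 1) → k) : f v = f' v := by
  refine LinearMap.congr_fun ((Pi.basisFun k _).ext fun j => ?_) v
  rw [Pi.basisFun_apply, ← V_act_y_pow_single_zero α β r i hαβ j.2]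
  exact h j (Nat.le_of_lt_succ j.2)

theorem V_coact_act (h : LiuAlgebra n w γ) (v : Fin (liuTop n γ β i + 1) → k) :
    (V n w γ α β r i hαβ).coact ((V n w γ α β r i hαβ).act h v) =
      twist (V n w γ α β r i hαβ).act h ((V n w γ α β r i hαβ).coact v) := by
  set D := V n w γ α β r i hαβ
  refine map_act_of_generators (fun v => ?_)
    (V_linearMap_congr α β r i hαβ (f := D.coact ∘ₗ D.act (g n w γ))
      (f' := (twist D.act (g n w γ)).comp D.coact) ?_)
    (V_linearMap_congr α β r i hαβ (f := D.coact ∘ₗ D.act (y n w γ))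
      (f' := (twist D.act (y n w γ)).comp D.coact) ?_) h v
  · rw [twist_of_isGroupLikeElem_of_commute D.act isGroupLikeElem_x commute_x, V_act_x]
    simp [LinearMap.lTensor_smul, Module.End.one_eq_id]
  · intro a ha
    rw [LinearMap.comp_apply, LinearMap.comp_apply,
      act_g_act_y_pow D.act (V_act_g_single_zero α β r i hαβ), map_smul,
      V_coact_act_y_pow_of_le α β r i hαβ ha, map_sum, Finset.smul_sum]
    refine Finset.sum_congr rfl fun l hl => ?_
    rw [twist_tmul_of_isGroupLikeElem _ isGroupLikeElem_g, antipode_g,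
      g_mul_coactionCoeff_mul_ginv β r i (Nat.le_of_lt_succ (Finset.mem_range.mp hl)),
      act_g_act_y_pow _ (V_act_g_single_zero α β r i hαβ), TensorProduct.tmul_smul,
      ← TensorProduct.smul_tmul', smul_smul, mul_assoc, ← zpow_add₀ (gamma_ne_zero n γ)]
    ring_nf
  · intro a ha
    rw [LinearMap.comp_apply, LinearMap.comp_apply, act_y_act_y_pow,
      V_coact_act_y_pow_of_le α β r i hαβ ha,
      twist_y_sum_coactionCoeff _ r i (V_act_g_single_zero α β r i hαβ)]
    rcases ha.lt_or_eq with ha | rfl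
    · exact V_coact_act_y_pow_of_le α β r i hαβ ha
    · exact V_coact_act_y_pow_top_succ α β r i hαβ

theorem V_isYetterDrinfeld : (V n w γ α β r i hαβ).IsYetterDrinfeld :=
  isYetterDrinfeld_of_generator (V_coact_act α β r i hαβ)
    (exists_V_act_single_zero_eq α β r i hαβ) (isGroupLikeElem_xg r i)
    (V_coact_single_zero α β r i hαβ)

end V

end LiuAlgebra

/-! ## Simplicity and isomorphisms of the modules V(α, β, x^r g^i) -/

section Slice

variable {k H V W : Type*} [Field k] [AddCommGroup H] [Module k H] [AddCommGroup V] [Module k V]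
  [AddCommGroup W] [Module k W]

theorem lid_rTensor_assoc_tmul (φ : H →ₗ[k] k) (t : H ⊗[k] W) (v : V) :
    TensorProduct.lid k _ (φ.rTensor _ (TensorProduct.assoc k H W V (t ⊗ₜ v))) =
      TensorProduct.lid k _ (φ.rTensor _ t) ⊗ₜ v := by
  induction t with
  | zero => simp
  | add t t' ht ht' => simp only [TensorProduct.add_tmul, map_add, ht, ht']
  | tmul a b => simp [TensorProduct.smul_tmul']

theorem lid_rTensor_lTensor (φ : H →ₗ[k] k) (f : V →ₗ[k] W) (t : H ⊗[k] V) :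
    TensorProduct.lid k _ (φ.rTensor _ (f.lTensor _ t)) =
      f (TensorProduct.lid k _ (φ.rTensor _ t)) := by
  induction t with
  | zero => simp
  | add t t' ht ht' => simp only [map_add, ht, ht']
  | tmul a b => simp

theorem lid_rTensor_mem_of_mem_range_lTensor {W : Submodule k V} {t : H ⊗[k] V}
    (ht : t ∈ LinearMap.range (LinearMap.lTensor H W.subtype)) (φ : H →ₗ[k] k) :
    TensorProduct.lid k V (φ.rTensor V t) ∈ W := by
  obtain ⟨s, rfl⟩ := ht
  induction s with
  | zero => simp
  | add s s' hs hs' =>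
    simp only [map_add]
    exact W.add_mem hs hs'
  | tmul h v => simpa using W.smul_mem _ v.2

theorem tmul_right_injective_of_ne_zero {v : V} (hv : v ≠ 0) :
    Function.Injective fun h : H => h ⊗ₜ[k] v := by
  intro h h' e
  obtain ⟨φ, hφ⟩ := Module.Projective.exists_dual_ne_zero k hv
  have hφe := congrArg (fun t => TensorProduct.rid k H (φ.lTensor H t)) e
  simp only [LinearMap.lTensor_tmul, TensorProduct.rid_tmul] at hφe
  exact smul_right_injective H hφ hφe

end Slice

namespace LiuAlgebra

open ActionCoaction

universe u v

variable {k : Type u} [Field k] {n w : ℕ} {γ : k} [NeZero n] [hγ : Fact (IsPrimitiveRoot γ n)]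
  (α β : kˣ) (r i : ℤ) (hαβ : α ^ w = β ^ n)

section Morphism

variable {E : Type*} [AddCommGroup E] [Module k E] {N : ActionCoaction k (LiuAlgebra n w γ) E}

theorem exists_linearMap_V_act_y_pow (v : ℕ → E) :
    ∃ f : (Fin (liuTop n γ β i + 1) → k) →ₗ[k] E, ∀ l ≤ liuTop n γ β i,
      f ((V n w γ α β r i hαβ).act (y n w γ ^ l) (Pi.single 0 1)) = v l := by
  refine ⟨(Pi.basisFun k (Fin (liuTop n γ β i + 1))).constr k fun j => v j, fun l hl => ?_⟩
  rw [V_act_y_pow_single_zero α β r i hαβ (Nat.lt_succ_of_le hl), ← Pi.basisFun_apply]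
  exact (Pi.basisFun k _).constr_basis k _ _

theorem exists_isMorphism_V (hN : N.IsYetterDrinfeld) {v : E}
    (hx : N.act (x n w γ) v = (α : k) • v) (hg : N.act (g n w γ) v = (β : k) • v)
    (hv : N.coact v = xg n w γ r i ⊗ₜ v)
    (htop : N.act (y n w γ ^ (liuTop n γ β i + 1)) v = (1 - (β : k) ^ n) • v) :
    ∃ f, IsMorphism (V n w γ α β r i hαβ) N f ∧ f (Pi.single 0 1) = v := by
  obtain ⟨f, hf⟩ := exists_linearMap_V_act_y_pow (γ := γ) α β r i hαβ
    fun l => N.act (y n w γ ^ l) v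
  have hf0 : f (Pi.single 0 1) = v := by simpa using hf 0 (Nat.zero_le _)
  have hfx (u) : f ((V n w γ α β r i hαβ).act (x n w γ) u) = N.act (x n w γ) (f u) := by
    refine V_linearMap_congr α β r i hαβ (f := f ∘ₗ (V n w γ α β r i hαβ).act (x n w γ))
      (f' := N.act (x n w γ) ∘ₗ f) (fun l hl => ?_) u
    have hcomm : N.act (x n w γ) (N.act (y n w γ ^ l) v) =
        N.act (y n w γ ^ l) (N.act (x n w γ) v) := by
      rw [← Module.End.mul_apply, ← map_mul, commute_x, map_mul, Module.End.mul_apply]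
    rw [LinearMap.comp_apply, LinearMap.comp_apply, V_act_x, LinearMap.smul_apply,
      Module.End.one_apply, map_smul, hf l hl, hcomm, hx, map_smul]
  have hfg (u) : f ((V n w γ α β r i hαβ).act (g n w γ) u) = N.act (g n w γ) (f u) := by
    refine V_linearMap_congr α β r i hαβ (f := f ∘ₗ (V n w γ α β r i hαβ).act (g n w γ))
      (f' := N.act (g n w γ) ∘ₗ f) (fun l hl => ?_) u
    rw [LinearMap.comp_apply, LinearMap.comp_apply, hf l hl, act_g_act_y_pow _ hg,
      act_g_act_y_pow _ (V_act_g_single_zero α β r i hαβ), map_smul, hf l hl]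
  have hfy (u) : f ((V n w γ α β r i hαβ).act (y n w γ) u) = N.act (y n w γ) (f u) := by
    refine V_linearMap_congr α β r i hαβ (f := f ∘ₗ (V n w γ α β r i hαβ).act (y n w γ))
      (f' := N.act (y n w γ) ∘ₗ f) (fun l hl => ?_) u
    rw [LinearMap.comp_apply, LinearMap.comp_apply, hf l hl, act_y_act_y_pow, act_y_act_y_pow]
    rcases hl.lt_or_eq with hl | rfl
    · exact hf _ hl
    · rw [V_act_y_pow_top_succ, map_smul, hf0, htop]
  refine ⟨f, ⟨map_act_of_generators hfx hfg hfy, V_linearMap_congr α β r i hαβ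
    (f := N.coact ∘ₗ f) (f' := f.lTensor _ ∘ₗ (V n w γ α β r i hαβ).coact) fun l hl => ?_⟩, hf0⟩
  rw [LinearMap.comp_apply, LinearMap.comp_apply, hf l hl, coact_act_y_pow hN hg hv,
    V_coact_act_y_pow_of_le α β r i hαβ hl, map_sum]
  refine Finset.sum_congr rfl fun j hj => ?_
  rw [LinearMap.lTensor_tmul, hf j ((Nat.le_of_lt_succ (Finset.mem_range.mp hj)).trans hl)]

end Morphism

theorem lid_rTensor_V_coact_single {φ : LiuAlgebra n w γ →ₗ[k] k} (p : Fin (liuTop n γ β i + 1)) :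
    TensorProduct.lid k _ (φ.rTensor _ ((V n w γ α β r i hαβ).coact (Pi.single p 1))) =
      ∑ l with l ≤ p, φ (coactionCoeff n w γ β r i p l) • Pi.single l 1 := by
  simp only [V_coact, map_sum, LinearMap.rTensor_tmul, TensorProduct.lid_tmul]

variable [NeZero w]

theorem coord_coactionCoeff {j p l : ℕ} (hj : j < n) (hpj : p ≤ j) (hlp : l ≤ p) :
    (pbwBasis n w γ).coord (⟨j, hj⟩, ⟨_, r, i - j, rfl⟩) (coactionCoeff n w γ β r i p l) =
      if p = j ∧ l = 0 then coeffScalar γ β i j 0 else 0 := by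
  obtain ⟨d, rfl⟩ := Nat.exists_eq_add_of_le' hlp
  have hcoord := coord_y_pow_mul (w := w) (γ := γ) (⟨j, hj⟩, ⟨_, r, i - j, rfl⟩)
    (show d < n by omega) ⟨xg n w γ r (i - (d + l : ℕ)), r, _, rfl⟩
  rw [coactionCoeff_eq, map_smul, hcoord]
  by_cases h : d + l = j ∧ l = 0
  · obtain ⟨rfl, rfl⟩ := h
    simp
  · have hd : d ≠ j := by omega
    rw [if_neg h, if_neg fun h' => hd h'.1, smul_zero]

/-- The functional reads off the coefficient of `y^j x^r g^(i - j)` for the largest index `j` in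
the support of `v`; only the term `c(j, 0) ⊗ v₀` of `δ(v)` involves this monomial. -/
theorem exists_lid_rTensor_V_coact_eq {v : Fin (liuTop n γ β i + 1) → k} (hv : v ≠ 0) :
    ∃ φ : LiuAlgebra n w γ →ₗ[k] k,
      TensorProduct.lid k _ (φ.rTensor _ ((V n w γ α β r i hαβ).coact v)) = Pi.single 0 1 := by
  obtain ⟨j, hj0, hjmax⟩ : ∃ j, v j ≠ 0 ∧ ∀ p, j < p → v p = 0 := by
    obtain ⟨j, hj⟩ := (Set.toFinite {j | v j ≠ 0}).exists_maximal (Function.ne_iff.mp hv)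
    exact ⟨j, hj.prop, fun p hp => not_not.mp fun h => hj.not_prop_of_gt hp h⟩
  have hjtop : (j : ℕ) ≤ liuTop n γ β i := Nat.le_of_lt_succ j.2
  let φ := (pbwBasis n w γ).coord
    (⟨j, hjtop.trans_lt (liuTop_lt β i)⟩, ⟨_, r, i - (j : ℕ), rfl⟩)
  let ψ := (TensorProduct.lid k _).toLinearMap ∘ₗ φ.rTensor _ ∘ₗ (V n w γ α β r i hαβ).coact
  have hlt (p) (hp : p < j) : ψ (Pi.single p 1) = 0 := by
    refine (lid_rTensor_V_coact_single α β r i hαβ p).trans (Finset.sum_eq_zero fun l hl => ?_)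
    have hlp : (l : ℕ) ≤ p := (Finset.mem_filter.mp hl).2
    rw [coord_coactionCoeff β r i _ hp.le hlp, if_neg fun h => hp.ne (Fin.ext h.1), zero_smul]
  have heq : ψ (Pi.single j 1) = coeffScalar γ β i j 0 • Pi.single 0 1 := by
    refine (lid_rTensor_V_coact_single α β r i hαβ j).trans ?_
    rw [Finset.sum_eq_single_of_mem 0 (by simp) fun l hl hl0 => ?_]
    · exact congrArg (· • Pi.single 0 1)
        ((coord_coactionCoeff β r i _ le_rfl (Nat.zero_le _)).trans (if_pos ⟨rfl, rfl⟩))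
    · have hlj : (l : ℕ) ≤ j := (Finset.mem_filter.mp hl).2
      rw [coord_coactionCoeff β r i _ le_rfl hlj, if_neg fun h => hl0 (Fin.ext h.2), zero_smul]
  have hψ : ψ v = (v j * coeffScalar γ β i j 0) • Pi.single 0 1 := by
    conv_lhs => rw [← (Pi.basisFun k _).sum_repr v, map_sum]
    rw [Finset.sum_eq_single j (fun p _ hp => ?_) (by simp)]
    · simp [heq, smul_smul]
    · rcases hp.lt_or_gt with hp | hp
      · simp [hlt p hp]
      · simp [hjmax p hp]
  refine ⟨(v j * coeffScalar γ β i j 0)⁻¹ • φ, ?_⟩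
  rw [LinearMap.rTensor_smul, LinearMap.smul_apply, map_smul]
  exact (congrArg _ hψ).trans
    (inv_smul_smul₀ (mul_ne_zero hj0 (coeffScalar_ne_zero hjtop)) _)

theorem V_isSimple : (V n w γ α β r i hαβ).IsSimpleYetterDrinfeld := by
  refine ⟨V_isYetterDrinfeld α β r i hαβ, inferInstance, fun W hW => or_iff_not_imp_left.mpr ?_⟩
  intro hW0
  obtain ⟨v, hvW, hv0⟩ := W.ne_bot_iff.mp hW0
  obtain ⟨φ, hφ⟩ := exists_lid_rTensor_V_coact_eq α β r i hαβ hv0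
  have hW1 : Pi.single 0 1 ∈ W := hφ ▸ lid_rTensor_mem_of_mem_range_lTensor (hW.2 v hvW) φ
  refine eq_top_iff.mpr fun u _ => ?_
  obtain ⟨a, rfl⟩ := exists_V_act_single_zero_eq α β r i hαβ u
  exact hW.1 a _ hW1

theorem exists_smul_eq_single_zero {h : LiuAlgebra n w γ} {v : Fin (liuTop n γ β i + 1) → k}
    (hv0 : v ≠ 0) (hv : (V n w γ α β r i hαβ).coact v = h ⊗ₜ v) :
    ∃ c : k, c • v = Pi.single 0 1 := by
  obtain ⟨φ, hφ⟩ := exists_lid_rTensor_V_coact_eq α β r i hαβ hv0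
  exact ⟨φ h, by simpa [hv] using hφ⟩

theorem eq_of_V_coact_eq_tmul {a b : k} {h : LiuAlgebra n w γ}
    {v : Fin (liuTop n γ β i + 1) → k} (hv0 : v ≠ 0)
    (hx : (V n w γ α β r i hαβ).act (x n w γ) v = a • v)
    (hg : (V n w γ α β r i hαβ).act (g n w γ) v = b • v)
    (hv : (V n w γ α β r i hαβ).coact v = h ⊗ₜ v) :
    a = α ∧ b = β ∧ h = xg n w γ r i := by
  obtain ⟨c, hc⟩ := exists_smul_eq_single_zero α β r i hαβ hv0 hv
  have he0 : (Pi.single 0 1 : Fin (liuTop n γ β i + 1) → k) ≠ 0 := by simp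
  refine ⟨smul_left_injective k hv0 ?_, smul_left_injective k he0 ?_,
    tmul_right_injective_of_ne_zero (k := k) he0 ?_⟩
  · simpa [V_act_x] using hx.symm
  · change b • _ = (β : k) • _
    rw [← V_act_g_single_zero α β r i hαβ, ← hc, map_smul, hg, smul_comm]
  · change h ⊗ₜ[k] _ = xg n w γ r i ⊗ₜ[k] _
    rw [← V_coact_single_zero α β r i hαβ, ← hc, map_smul, hv, TensorProduct.tmul_smul]

theorem eq_of_V_isomorphic {α β α' β' : kˣ} {r i r' i' : ℤ} {h : α ^ w = β ^ n}
    {h' : α' ^ w = β' ^ n} (hiso : (V n w γ α β r i h).Isomorphic (V n w γ α' β' r' i' h')) :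
    α = α' ∧ β = β' ∧ xg n w γ r i = xg n w γ r' i' := by
  obtain ⟨e, hact, hcoact⟩ := hiso
  obtain ⟨hα, hβ, hxg⟩ := eq_of_V_coact_eq_tmul α' β' r' i' h' (v := e (Pi.single 0 1))
    (a := α) (b := β) (h := xg n w γ r i) (by simp)
    (by rw [← hact, V_act_x, LinearMap.smul_apply, Module.End.one_apply, map_smul])
    (by rw [← hact, V_act_g_single_zero, map_smul])
    (by rw [hcoact, V_coact_single_zero, LinearMap.lTensor_tmul, LinearEquiv.coe_coe])
  exact ⟨Units.ext hα, Units.ext hβ, hxg⟩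

theorem V_isomorphic_of_eigenvector {E : Type*} [AddCommGroup E] [Module k E]
    {N : ActionCoaction k (LiuAlgebra n w γ) E} (hN : N.IsSimpleYetterDrinfeld) {v : E}
    (hv0 : v ≠ 0) (hx : N.act (x n w γ) v = (α : k) • v) (hg : N.act (g n w γ) v = (β : k) • v)
    (hv : N.coact v = xg n w γ r i ⊗ₜ v)
    (htop : N.act (y n w γ ^ (liuTop n γ β i + 1)) v = (1 - (β : k) ^ n) • v) :
    (V n w γ α β r i hαβ).Isomorphic N := by
  obtain ⟨f, hf, hfv⟩ := exists_isMorphism_V α β r i hαβ hN.isYetterDrinfeld hx hg hv htop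
  refine hf.isomorphic (V_isSimple α β r i hαβ) hN fun h0 => hv0 ?_
  rw [← hfv, h0, LinearMap.zero_apply]

theorem V_isomorphic_of_xg_eq {r' i' : ℤ} (h : xg n w γ r i = xg n w γ r' i') :
    (V n w γ α β r i hαβ).Isomorphic (V n w γ α β r' i' hαβ) := by
  refine V_isomorphic_of_eigenvector α β r i hαβ (V_isSimple α β r' i' hαβ) (v := Pi.single 0 1)
    (by simp)
    (by rw [V_act_x, LinearMap.smul_apply, Module.End.one_apply]) (V_act_g_single_zero _ _ _ _ _)
    (h ▸ V_coact_single_zero _ _ _ _ _) ?_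
  rw [liuTop_eq_of_xg_eq β h, V_act_y_pow_top_succ]

end LiuAlgebra

/-! ## Classification of the simple modules -/

section AlgClosed

variable {k V : Type*} [Field k] [IsAlgClosed k] [AddCommGroup V] [Module k V] [Nontrivial V]

open Polynomial in
theorem exists_hasEigenvalue_of_isIntegral {f : Module.End k V} (hf : IsIntegral k f) :
    ∃ c, f.HasEigenvalue c := by
  obtain ⟨c, hc⟩ := IsAlgClosed.exists_root (minpoly k f) (minpoly.degree_pos hf).ne'
  obtain ⟨q, hq⟩ := dvd_iff_isRoot.mpr hc
  have hq0 : q ≠ 0 := by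
    rintro rfl
    exact minpoly.ne_zero hf (hq.trans (mul_zero _))
  have hfq : aeval f q ≠ 0 := fun h => by
    have hdeg := natDegree_le_of_dvd (minpoly.dvd k f h) hq0
    rw [hq, natDegree_mul (X_sub_C_ne_zero c) hq0, natDegree_X_sub_C] at hdeg
    omega
  obtain ⟨v, hv⟩ := DFunLike.ne_iff.mp hfq
  refine ⟨c, Module.End.hasEigenvalue_of_hasEigenvector
    (Module.End.hasEigenvector_iff.mpr ⟨Module.End.mem_eigenspace_iff.mpr ?_, hv⟩)⟩
  simpa [sub_eq_zero, hq] using LinearMap.congr_fun (minpoly.aeval k f) v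

/-- By Zariski's lemma a simple quotient of `V` as an `A`-module is one-dimensional, and an element
of `A` acts on it by a scalar. -/
theorem exists_not_surjective_sub_smul {A : Type*} [CommRing A] [Algebra k A]
    [Algebra.FiniteType k A] (ρ : A →ₐ[k] Module.End k V) {S : Set V} (hS : S.Finite)
    (hgen : ∀ N : Submodule k V, (∀ a, N ≤ N.comap (ρ a)) → S ⊆ N → N = ⊤) (a : A) :
    ∃ c : k, ¬ Function.Surjective (ρ a - c • 1 : Module.End k V) := by
  let _ : Module A V := Module.compHom V ρ.toRingHom
  have hsmul (b : A) (v : V) : b • v = ρ b v := rfl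
  have : IsScalarTower k A V := ⟨fun c b v => by simp [hsmul]⟩
  have : Module.Finite A V := by
    refine ⟨Submodule.fg_def.mpr ⟨S, hS, ?_⟩⟩
    rw [← Submodule.restrictScalars_eq_top_iff k]
    exact hgen _ (fun b v hv => Submodule.smul_mem _ b hv) Submodule.subset_span
  obtain ⟨N, hN⟩ := IsCoatomic.exists_coatom (Submodule A V)
  have := isSimpleModule_iff_isCoatom.mpr hN
  let m := Module.annihilator A (V ⧸ N)
  have : m.IsMaximal := IsSimpleModule.annihilator_isMaximal
  let _ := Ideal.Quotient.field m
  have := finite_of_finite_type_of_isJacobsonRing k (A ⧸ m)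
  obtain ⟨c, hc⟩ := (IsAlgClosed.algebraMap_bijective_of_isIntegral (k := k) (K := A ⧸ m)).2
    (Ideal.Quotient.mk m a)
  have hm : a - algebraMap k A c ∈ m := Ideal.Quotient.eq.mp hc.symm
  refine ⟨c, fun hsurj => hN.1 (eq_top_iff.mpr fun v _ => ?_)⟩
  obtain ⟨u, rfl⟩ := hsurj v
  have hu := Module.mem_annihilator.mp hm (N.mkQ u)
  rw [← map_smul, Submodule.mkQ_apply, Submodule.Quotient.mk_eq_zero] at hu
  simpa [hsmul, sub_smul] using hu

end AlgClosed

namespace LiuAlgebra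

open ActionCoaction

variable {k : Type*} [Field k] {n w : ℕ} {γ : k} [NeZero n]

theorem xg_add_mul (r i q : ℤ) : xg n w γ r (i + n * q) = xg n w γ (r + w * q) i := by
  have hgx : gUnit n w γ ^ n = xUnit n w γ ^ w := Units.ext (g_pow n w γ)
  have hq : xg n w γ 0 (n * q) = xg n w γ (w * q) 0 := by
    simp only [xg, zpow_mul, zpow_natCast, hgx, zpow_zero, one_mul, mul_one]
  rw [← add_zero r, ← xg_mul, hq, xg_mul, add_zero, add_zero]

variable (n w γ) in
/-- The subalgebra of Laurent polynomials in the central element `x`, as a homomorphism from the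
group algebra of `ℤ`. -/
noncomputable def laurentX : AddMonoidAlgebra k ℤ →ₐ[k] LiuAlgebra n w γ :=
  AddMonoidAlgebra.lift k _ ℤ ((Units.coeHom _).comp (zpowersHom _ (xUnit n w γ)))

theorem laurentX_single (r : ℤ) : laurentX n w γ (.single r 1) = xg n w γ r 0 := by
  rw [laurentX, AddMonoidAlgebra.lift_single, one_smul]
  simp [xg]

variable [hγ : Fact (IsPrimitiveRoot γ n)]

section Comodule

variable [NeZero w] {M : Type*} [AddCommGroup M] [Module k M] [Nontrivial M]
  {D : ActionCoaction k (LiuAlgebra n w γ) M}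

/-- Among the PBW basis vectors occurring in the coaction of a nonzero vector, one with the largest
power of `y` has a vector coefficient on which `H` coacts by a single monomial `x^r g^i`. -/
theorem exists_coact_eq_xg_tmul (hD : D.IsYetterDrinfeld) :
    ∃ (v : M) (r i : ℤ), v ≠ 0 ∧ D.coact v = xg n w γ r i ⊗ₜ v := by
  classical
  obtain ⟨v, hv⟩ := exists_ne (0 : M)
  set b := pbwBasis n w γ
  set s := TensorProduct.equivFinsuppOfBasisLeft b (D.coact v) with hs
  have hcoact : D.coact v = s.sum fun p m => b p ⊗ₜ[k] m := by
    rw [← TensorProduct.equivFinsuppOfBasisLeft_symm_apply, hs, LinearEquiv.symm_apply_apply]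
  have hs0 : s ≠ 0 := fun h0 => hv (by simpa [hcoact, h0] using (hD.counit_coact v).symm)
  obtain ⟨p, hp, hmax⟩ := s.support.exists_max_image Prod.fst (Finsupp.support_nonempty_iff.mpr hs0)
  have hsp : s p = TensorProduct.lid k _ ((b.coord p).rTensor _ (D.coact v)) := by
    rw [hs, TensorProduct.equivFinsuppOfBasisLeft_apply]
  have hslice (q) (hq : q ∈ s.support) : TensorProduct.lid k _ ((b.coord p).rTensor _
      (Coalgebra.comul (R := k) (b q))) = if q = p then g n w γ ^ (p.1 : ℕ) * p.2 else 0 :=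
    coord_rTensor_comul (hmax q hq) p.2 q.2
  have hcoact_sp : D.coact (s p) = (g n w γ ^ (p.1 : ℕ) * p.2) ⊗ₜ s p := by
    rw [hsp, ← lid_rTensor_lTensor, ← hD.coassoc, ← hsp, hcoact, Finsupp.sum]
    simp only [map_sum, LinearMap.rTensor_tmul, lid_rTensor_assoc_tmul]
    rw [Finset.sum_eq_single_of_mem p hp, hslice p hp, if_pos rfl]
    intro q hq hqp
    rw [hslice q hq, if_neg hqp, TensorProduct.zero_tmul]
  obtain ⟨r, i, hri⟩ := p.2.2
  rw [hri, g_pow_eq_xg, xg_mul] at hcoact_sp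
  exact ⟨s p, _, _, Finsupp.mem_support_iff.mp hp, hcoact_sp⟩

end Comodule

section Simple

variable {M : Type*} [AddCommGroup M] [Module k M] {D : ActionCoaction k (LiuAlgebra n w γ) M}

/-- The vectors `y^a g^i v` with `a, i < n` generate `M` over the Laurent polynomials in `x`. -/
theorem eq_top_of_laurentX_stable (hD : D.IsSimpleYetterDrinfeld) {v : M} (hv : v ≠ 0)
    {h : LiuAlgebra n w γ} (hc : D.coact v = h ⊗ₜ v) {N : Submodule k M}
    (hN : ∀ p, N ≤ N.comap (D.act (laurentX n w γ p)))
    (hmem : ∀ a i : Fin n, D.act (y n w γ ^ (a : ℕ) * xg n w γ 0 (i : ℕ)) v ∈ N) : N = ⊤ := by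
  have hn : (n : ℤ) ≠ 0 := Nat.cast_ne_zero.mpr (NeZero.ne n)
  have hspan : ⊤ ≤ N.comap (D.act.toLinearMap.flip v) := by
    refine (top_le_span_pbwMonomial (gamma_ne_zero n γ)).trans (Submodule.span_le.mpr ?_)
    rintro _ ⟨⟨a, _, r, i, rfl⟩, rfl⟩
    lift i % n to ℕ using Int.emod_nonneg i hn with d hd
    have hdn : d < n := by exact_mod_cast hd ▸ Int.emod_lt_of_pos i (by positivity)
    have hxg : xg n w γ r i = laurentX n w γ (.single (r + w * (i / n)) 1) * xg n w γ 0 d := by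
      rw [laurentX_single, xg_mul, add_zero, zero_add, ← xg_add_mul, hd, Int.emod_add_mul_ediv]
    have hcomm : Commute (laurentX n w γ (.single (r + w * (i / n)) 1)) (y n w γ ^ (a : ℕ)) := by
      rw [laurentX_single, commute_iff_eq, xg_mul_y_pow (gamma_ne_zero n γ)]
      simp
    have hmem' := hN (.single (r + w * (i / n)) 1) (hmem a ⟨d, hdn⟩)
    rwa [Submodule.mem_comap, ← Module.End.mul_apply, ← map_mul, ← mul_assoc, hcomm.eq, mul_assoc,
      ← hxg] at hmem'
  refine eq_top_iff.mpr fun u _ => ?_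
  obtain ⟨a, rfl⟩ := hD.exists_act_eq hv hc u
  exact hspan (Submodule.mem_top (x := a))

theorem act_y_pow_liuTop_succ (hD : D.IsSimpleYetterDrinfeld) {α β : kˣ} (hαβ : α ^ w = β ^ n)
    (hx : D.act (x n w γ) = (α : k) • 1) {r i : ℤ} {v : M} (hv0 : v ≠ 0)
    (hg : D.act (g n w γ) v = (β : k) • v) (hv : D.coact v = xg n w γ r i ⊗ₜ v) :
    D.act (y n w γ ^ (liuTop n γ β i + 1)) v = (1 - (β : k) ^ n) • v := by
  have hyn : D.act (y n w γ) ^ n = (1 - (β : k) ^ n) • 1 := by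
    rw [← map_pow, y_pow, map_sub, map_one, map_pow, hx, smul_pow, one_pow, sub_smul, one_smul,
      ← Units.val_pow_eq_pow_val, hαβ, Units.val_pow_eq_pow_val]
  by_cases hβ : (β : k) ^ n = 1
  · rw [hβ, sub_self, zero_smul]
    by_contra hu0
    set u := D.act (y n w γ ^ (liuTop n γ β i + 1)) v with hu
    have hcoact : D.coact u = xg n w γ r (i - (liuTop n γ β i + 1 : ℕ)) ⊗ₜ u := by
      rw [hu, coact_act_y_pow hD.isYetterDrinfeld hg hv, Finset.sum_range_succ,
        coactionCoeff_self, Finset.sum_eq_zero, zero_add]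
      intro l hl
      rcases eq_or_ne l 0 with rfl | hl0
      · rw [coactionCoeff_liuTop_succ_zero, hβ, sub_self, zero_smul, TensorProduct.zero_tmul]
      · rw [coactionCoeff_liuTop_succ β r i hl0 (Finset.mem_range_succ_iff.mp hl),
          TensorProduct.zero_tmul]
    have hsurj : Function.Surjective (D.act (y n w γ)) := fun m => by
      obtain ⟨a, rfl⟩ := hD.exists_act_eq hu0 hcoact m
      obtain ⟨a', ha'⟩ := exists_mul_y_eq_y_mul (gamma_ne_zero n γ) a
      refine ⟨D.act (a' * y n w γ ^ liuTop n γ β i) v, ?_⟩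
      rw [hu, ← Module.End.mul_apply, ← Module.End.mul_apply, ← map_mul, ← map_mul, ← mul_assoc,
        ← ha', pow_succ', mul_assoc]
    obtain ⟨m, hm⟩ := hsurj.iterate n v
    rw [← Module.End.coe_pow, hyn, hβ, sub_self, zero_smul] at hm
    exact hv0 hm.symm
  · rw [liuTop_eq_of_pow_ne_one i hβ, map_pow, hyn, LinearMap.smul_apply, Module.End.one_apply]

variable [IsAlgClosed k]

theorem exists_act_g_eq_smul (hD : D.IsYetterDrinfeld) {α : kˣ}
    (hx : D.act (x n w γ) = (α : k) • 1) {r i : ℤ} {u : M} (hu0 : u ≠ 0)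
    (hu : D.coact u = xg n w γ r i ⊗ₜ u) :
    ∃ (β : kˣ) (v : M), α ^ w = β ^ n ∧ v ≠ 0 ∧ D.act (g n w γ) v = (β : k) • v ∧
      D.coact v = xg n w γ r i ⊗ₜ v := by
  let U := LinearMap.eqLocus D.coact (TensorProduct.mk k _ M (xg n w γ r i))
  have : Nontrivial U := ⟨⟨u, hu⟩, 0, fun h => hu0 (congrArg Subtype.val h)⟩
  have hcomm : Commute (g n w γ) (xg n w γ r i) := by
    rw [g_eq_xg, commute_iff_eq, xg_mul, xg_mul, add_comm, add_comm 1]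
  let T : Module.End k U := (D.act (g n w γ)).restrict fun _ hm =>
    hD.coact_act_of_isGroupLikeElem isGroupLikeElem_g hcomm hm
  have hgn : D.act (g n w γ) ^ n = (α : k) ^ w • 1 := by
    rw [← map_pow, g_pow, map_pow, hx, smul_pow, one_pow]
  have hT : T ^ n = algebraMap k _ ((α : k) ^ w) := by
    ext m
    rw [show T ^ n = _ from Module.End.pow_restrict n _, LinearMap.coe_restrict_apply, hgn]
    rfl
  obtain ⟨b, hb⟩ := exists_hasEigenvalue_of_isIntegral
    (IsIntegral.of_pow (NeZero.pos n) (hT ▸ isIntegral_algebraMap))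
  obtain ⟨v, hv⟩ := hb.exists_hasEigenvector
  have hαb : (α : k) ^ w = b ^ n := by
    refine smul_left_injective k hv.2 ?_
    have := hv.pow_apply n
    rw [hT] at this
    exact this
  have hb0 : b ≠ 0 := fun h => pow_ne_zero w α.ne_zero (by rw [hαb, h, zero_pow (NeZero.ne n)])
  exact ⟨Units.mk0 b hb0, v, Units.ext (by simpa using hαb), fun h => hv.2 (Subtype.ext h),
    congrArg Subtype.val hv.apply_eq_smul, v.2⟩

variable [NeZero w]

theorem exists_act_x_eq_smul (hD : D.IsSimpleYetterDrinfeld) :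
    ∃ α : kˣ, D.act (x n w γ) = (α : k) • 1 := by
  have := hD.nontrivial
  obtain ⟨v, r, i, hv, hc⟩ := exists_coact_eq_xg_tmul hD.isYetterDrinfeld
  obtain ⟨α, hα⟩ := exists_not_surjective_sub_smul (D.act.comp (laurentX n w γ))
    (Set.finite_range fun p : Fin n × Fin n =>
      D.act (y n w γ ^ (p.1 : ℕ) * xg n w γ 0 (p.2 : ℕ)) v)
    (fun N hN hS => eq_top_of_laurentX_stable hD hv hc hN fun a i => hS ⟨(a, i), rfl⟩)
    (.single 1 1)
  rw [AlgHom.comp_apply, laurentX_single, ← x_eq_xg] at hα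
  have hx := hD.act_eq_smul isGroupLikeElem_x commute_x hα
  refine ⟨Units.mk0 α ?_, hx⟩
  rintro rfl
  have hinv : D.act (xinv n w γ * x n w γ) v = v := by
    rw [xinv_mul_x, map_one, Module.End.one_apply]
  rw [map_mul, hx, zero_smul, mul_zero] at hinv
  exact hv hinv.symm

theorem exists_isomorphic_V (hD : D.IsSimpleYetterDrinfeld) :
    ∃ (α β : kˣ) (r i : ℤ) (h : α ^ w = β ^ n), D.Isomorphic (V n w γ α β r i h) := by
  have := hD.nontrivial
  obtain ⟨α, hx⟩ := exists_act_x_eq_smul hD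
  obtain ⟨u, r, i, hu0, hu⟩ := exists_coact_eq_xg_tmul hD.isYetterDrinfeld
  obtain ⟨β, v, hαβ, hv0, hg, hv⟩ := exists_act_g_eq_smul hD.isYetterDrinfeld hx hu0 hu
  have htop := act_y_pow_liuTop_succ hD hαβ hx hv0 hg hv
  have hxv : D.act (x n w γ) v = (α : k) • v := by rw [hx]; rfl
  exact ⟨α, β, r, i, hαβ, (V_isomorphic_of_eigenvector α β r i hαβ hD hv0 hxv hg hv htop).symm⟩

end Simple

end LiuAlgebra

theorem theorem4p4_general {k : Type*} [Field k] [IsAlgClosed k]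
    (n w : ℕ) [NeZero n] [NeZero w] (γ : k) [Fact (IsPrimitiveRoot γ n)] :
    (∀ (α β : kˣ) (r i : ℤ) (h : α ^ w = β ^ n),
      (LiuAlgebra.V n w γ α β r i h).IsSimpleYetterDrinfeld ∧
      (∀ j : ℤ, (β : k) = γ ^ j →
        Module.finrank k (Fin (liuTop n γ β i + 1) → k) = n + 1 - liuPhi n (-i - j)) ∧
      ((β : k) ^ n ≠ 1 → Module.finrank k (Fin (liuTop n γ β i + 1) → k) = n)) ∧
    (∀ (M : Type*) [AddCommGroup M] [Module k M] (D : ActionCoaction k (LiuAlgebra n w γ) M),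
      D.IsSimpleYetterDrinfeld →
        ∃ (α β : kˣ) (r i : ℤ) (h : α ^ w = β ^ n),
          D.Isomorphic (LiuAlgebra.V n w γ α β r i h)) ∧
    (∀ (α β α' β' : kˣ) (r i r' i' : ℤ) (h : α ^ w = β ^ n) (h' : α' ^ w = β' ^ n),
      (LiuAlgebra.V n w γ α β r i h).Isomorphic (LiuAlgebra.V n w γ α' β' r' i' h') ↔
        α = α' ∧ β = β' ∧ LiuAlgebra.xg n w γ r i = LiuAlgebra.xg n w γ r' i') := by
  refine ⟨fun α β r i h => ⟨LiuAlgebra.V_isSimple α β r i h, fun j hj => ?_, fun hβ => ?_⟩,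
    fun M _ _ D hD => LiuAlgebra.exists_isomorphic_V hD,
    fun α β α' β' r i r' i' h h' => ⟨LiuAlgebra.eq_of_V_isomorphic, ?_⟩⟩
  · have hφ := ((liuPhi_unique n (-i - j) _).mp rfl).2.1
    rw [Module.finrank_fin_fun, liuTop_eq_of_eq_zpow i hj]
    omega
  · rw [Module.finrank_fin_fun, liuTop_eq_of_pow_ne_one i hβ]
  · rintro ⟨rfl, rfl, hxg⟩
    exact LiuAlgebra.V_isomorphic_of_xg_eq α β r i h hxg

theorem theorem4p4 {k : Type*} [Field k] [IsAlgClosed k] [CharZero k]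
    (n w : ℕ) [NeZero n] [NeZero w] (γ : k) [Fact (IsPrimitiveRoot γ n)] :
    -- every `V(α, β, x^r g^i)` is a simple Yetter–Drinfeld module, of the indicated dimension
    (∀ (α β : kˣ) (r i : ℤ) (h : α ^ w = β ^ n),
      (LiuAlgebra.V n w γ α β r i h).IsSimpleYetterDrinfeld ∧
      (∀ j : ℤ, (β : k) = γ ^ j →
        Module.finrank k (Fin (liuTop n γ β i + 1) → k) = n + 1 - liuPhi n (-i - j)) ∧
      ((β : k) ^ n ≠ 1 → Module.finrank k (Fin (liuTop n γ β i + 1) → k) = n)) ∧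
    -- every simple Yetter–Drinfeld module is isomorphic to one of them
    (∀ (M : Type*) [AddCommGroup M] [Module k M] (D : ActionCoaction k (LiuAlgebra n w γ) M),
      D.IsSimpleYetterDrinfeld →
        ∃ (α β : kˣ) (r i : ℤ) (h : α ^ w = β ^ n),
          D.Isomorphic (LiuAlgebra.V n w γ α β r i h)) ∧
    -- the isomorphism criterion
    (∀ (α β α' β' : kˣ) (r i r' i' : ℤ) (h : α ^ w = β ^ n) (h' : α' ^ w = β' ^ n),
      (LiuAlgebra.V n w γ α β r i h).Isomorphic (LiuAlgebra.V n w γ α' β' r' i' h') ↔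
        α = α' ∧ β = β' ∧ LiuAlgebra.xg n w γ r i = LiuAlgebra.xg n w γ r' i') :=
  theorem4p4_general n w γ
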